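/- Let $\Gamma$ be one of the congruence subgroups $\Gamma_0(N),\Gamma_1(N),\Gamma(N)$ of $SL(2,\mathbb Z)$, $N\ge 1$, let $\mathrm{vol}(\Gamma\backslash H)$ be the hyperbolic volume of a fundamental domain of $\Gamma$ in the upper half-plane $H$, and let $l\ge 1$ be an integer. Let $\Gamma_2,\Gamma_3$ be the Barnes–Vignéras double and triple gamma functions, $$\frac1{\Gamma_2(z+1)}=e^{(-\frac12-\frac\gamma2)z^2+(-\frac12-\zeta'(0))z}\prod_{k\ge1}\Big(1+\frac zk\Big)^k e^{-z+\frac{z^2}{2k}},$$ $$\Gamma_3(z+1)=e^{(-\frac14-\frac\gamma6)z^3+(\frac18-\frac{\zeta'(0)}2+\frac\gamma4)z^2+(\frac7{24}+\zeta'(-1)+\frac{\zeta'(0)}2)z}\prod_{k\ge1}\Big(1+\frac zk\Big)^{-\frac{k(k+1)}2}e^{\frac{z^3}{6k}+(-\frac14-\frac1{4k})z^2+(\frac12+\frac k2)z}.$$ Put $k_1(l)=(2\pi)^{-\frac{l-1}2}l^{-\frac12}$ and $k_2(l)=A^{1-l^2}e^{\frac{l^2-1}{12}}(2\pi)^{-\frac{l-1}2}l^{-\frac5{12}}$,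 where $A$ is the Glaisher–Kinkelin constant, $\log A=\lim_{n\to\infty}\{\sum_{k=1}^n k\log k-(\frac{n^2}2+\frac n2+\frac1{12})\log n+\frac{n^2}4\}$, and $$F_l(s)=\exp\Big\{-\frac sl\log\big(k_2(l)^{-2}k_1(l)\big)+\frac{s(s+l)}2\log 2\pi+\frac{s(s+l)(3-2s-l)}{6l}\log l\Big\}\prod_{r=0}^{l-1}\Gamma_3\Big(\frac{s+l+r}l\Big)^{-2l}\Gamma_2\Big(\frac{s+l+r}l\Big)^{-2r+2l-1}.$$ Define $$\Xi_I(s)=\exp\Big\{\frac{\mathrm{vol}(\Gamma\backslash H)}{2\pi}\Big(s\log2\pi+\log\frac{\Gamma_2(s)^2}{\Gamma(s)}\Big)\Big\},\qquad \Xi_{l\infty,I}(s)=\exp\Big\{\frac{\mathrm{vol}(\Gamma\backslash H)}{2\pi}\log F_l(s)\Big\},$$ where the logarithms are the holomorphic branches (on $\mathrm{Re}(s)>0$ and on $\mathrm{Re}(s)>-l$ respectively) that are real on the real axis. Let $$\phi_s(r)=\sum_{m=0}^\infty\Big\{\frac1{(s+lm+l-\frac12+ir)^2}-\frac1l\,\frac1{s+lm+\frac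 l2-\frac12+ir}+\frac1l\,\frac1{s+lm+\frac{3l}2-\frac12+ir}\Big\}$$ and $h(r)=\phi_s(r)+\phi_s(-r)$. Then $\Xi_{l\infty,I}$ is holomorphic and zero-free in $\mathrm{Re}(s)>1-l$, and $\Xi_I$ in $\mathrm{Re}(s)>0$. For $\mathrm{Re}(s)>\frac{1-l}2$ the following integral converges absolutely and $$\frac{\mathrm{vol}(\Gamma\backslash H)}{4\pi}\int_{-\infty}^{\infty}h(r)\,r\tanh(\pi r)\,dr=\frac{d^2}{ds^2}\log\Xi_{l\infty,I}(s)-\frac1l\,\frac{d}{ds}\log\Xi_I\Big(s+\frac l2\Big).$$ For $\mathrm{Re}(s)>1-l$, $$\Xi_{l\infty,I}(s)=\frac{\Xi_{l\infty,I}(s+l)}{\Xi_I(s+l)}.$$ -/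

import Mathlib

open MeasureTheory Filter
open scoped MatrixGroups UpperHalfPlane

noncomputable section

namespace HigherSelberg

/-- The volume of `Γ \ H` for the hyperbolic measure `dx dy / y ^ 2`, that is, the volume of a
fundamental domain. Since `-1` acts trivially on `H`, the covolume is taken for the image of `Γ`
in the group of transformations of `H`. -/
def vol (Γ : Subgroup SL(2, ℤ)) : ℝ :=
  (covolume (Γ.map (MulAction.toPermHom SL(2, ℤ) ℍ)) ℍ volume).toReal

/-- The Barnes–Vignéras double gamma function, by its Weierstrass product for `1 / Γ₂ (z + 1)`
(the index `k` of the product is shifted by one). At the poles it takes the value `0`. -/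
def Gamma₂ (w : ℂ) : ℂ :=
  let z := w - 1
  (Complex.exp ((-1 / 2 - (Real.eulerMascheroniConstant : ℂ) / 2) * z ^ 2
      + (-1 / 2 - deriv riemannZeta 0) * z)
    * ∏' k : ℕ, ((1 + z / (k + 1)) ^ (k + 1)
        * Complex.exp (-z + z ^ 2 / (2 * (k + 1)))))⁻¹

/-- The Barnes–Vignéras triple gamma function, by its Weierstrass product for `Γ₃ (z + 1)`
(the index `k` of the product is shifted by one, and `(k + 1) * (k + 2) / 2` is an exact
division). At the poles it takes the value `0`. -/
def Gamma₃ (w : ℂ) : ℂ :=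
  let z := w - 1
  Complex.exp ((-1 / 4 - (Real.eulerMascheroniConstant : ℂ) / 6) * z ^ 3
      + (1 / 8 - deriv riemannZeta 0 / 2 + (Real.eulerMascheroniConstant : ℂ) / 4) * z ^ 2
      + (7 / 24 + deriv riemannZeta (-1) + deriv riemannZeta 0 / 2) * z)
    * ∏' k : ℕ, (((1 + z / (k + 1)) ^ ((k + 1) * (k + 2) / 2))⁻¹
        * Complex.exp (z ^ 3 / (6 * (k + 1)) + (-1 / 4 - 1 / (4 * (k + 1))) * z ^ 2
            + (1 / 2 + ((k : ℂ) + 1) / 2) * z))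

/-- The branch of `log f` on a domain that is star-shaped about `1`, for `f` holomorphic and
zero-free there: it starts with the principal value of `log (f 1)` and is continued along the
segment from `1` to `s` by integrating `f' / f`. -/
def logBranch (f : ℂ → ℂ) (s : ℂ) : ℂ :=
  Complex.log (f 1) + ∫ t in (0 : ℝ)..1, (s - 1) * logDeriv f (1 + t * (s - 1))

/-- The Glaisher–Kinkelin constant `A`. -/
def glaisher : ℝ :=
  Real.exp (limUnder atTop fun N : ℕ =>
    ∑ k ∈ Finset.Icc 1 N, (k : ℝ) * Real.log k
      - ((N : ℝ) ^ 2 / 2 + (N : ℝ) / 2 + 1 / 12) * Real.log N + (N : ℝ) ^ 2 / 4)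

/-- The constant `k₁ (m)` of the multiplication formula of `Γ`. -/
def k₁ (m : ℕ) : ℝ :=
  (2 * Real.pi) ^ (-((m : ℝ) - 1) / 2) * (m : ℝ) ^ (-(1 / 2) : ℝ)

/-- The constant `k₂ (m)` of the multiplication formula of `Γ₂`. -/
def k₂ (m : ℕ) : ℝ :=
  glaisher ^ (1 - (m : ℝ) ^ 2) * Real.exp (((m : ℝ) ^ 2 - 1) / 12)
    * (2 * Real.pi) ^ (-((m : ℝ) - 1) / 2) * (m : ℝ) ^ (-(5 / 12) : ℝ)

/-- The function `F_l (s)`. -/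
def F (l : ℕ) (s : ℂ) : ℂ :=
  Complex.exp (-(s / l) * (Real.log (k₂ l ^ (-2 : ℤ) * k₁ l) : ℝ)
      + s * (s + l) / 2 * (Real.log (2 * Real.pi) : ℝ)
      + s * (s + l) * (3 - 2 * s - l) / (6 * l) * (Real.log l : ℝ))
    * ∏ r ∈ Finset.range l,
        (Gamma₃ ((s + l + r) / l) ^ (-2 * (l : ℤ))
          * Gamma₂ ((s + l + r) / l) ^ (-2 * (r : ℤ) + 2 * (l : ℤ) - 1))

/-- The identity factor `Ξ_I (s)` of the Selberg zeta function of `Γ`. -/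
def XiI (Γ : Subgroup SL(2, ℤ)) (s : ℂ) : ℂ :=
  Complex.exp ((vol Γ : ℂ) / (2 * Real.pi)
    * (s * (Real.log (2 * Real.pi) : ℝ)
        + logBranch (fun w => Gamma₂ w ^ 2 / Complex.Gamma w) s))

/-- The identity factor `Ξ_{l∞,I} (s)` of the higher Selberg zeta function of `Γ`. -/
def XiHigherI (Γ : Subgroup SL(2, ℤ)) (l : ℕ) (s : ℂ) : ℂ :=
  Complex.exp ((vol Γ : ℂ) / (2 * Real.pi) * logBranch (F l) s)

/-- The function `φ_s (r)`. -/
def phi (l : ℕ) (s : ℂ) (r : ℝ) : ℂ :=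
  ∑' m : ℕ, (1 / (s + l * m + l - 1 / 2 + Complex.I * r) ^ 2
    - 1 / l * (1 / (s + l * m + l / 2 - 1 / 2 + Complex.I * r))
    + 1 / l * (1 / (s + l * m + 3 * l / 2 - 1 / 2 + Complex.I * r)))

/-- The test function `h (r) = φ_s (r) + φ_s (-r)`. -/
def testFun (l : ℕ) (s : ℂ) (r : ℝ) : ℂ :=
  phi l s r + phi l s (-r)

end HigherSelberg

end

/-! Everything reduces to holomorphic logarithms. On `Re w > 0` the Weierstrass products of `Γ`,
`Γ₂`, `Γ₃` have logarithms `logΓ`, `logΓ₂`, `logΓ₃`, each a locally uniform limit of a polynomial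
minus a finite weighted sum of `log (w + n)`, with weights `1`, `n + 1` and `(n + 1) (n + 2) / 2`.
From these come `logF` on `Re s > -l` and `logG` on `Re s > 0`; the two factors are exponentials of
constant multiples of them, hence holomorphic and zero-free.

The ladder relation is `logF_add`: `logF l (s + l) = logF l s + logG (s + l)`. Moving `s` to `s + l`
raises every argument `(s + l + r) / l` by one, so `logΓ₃_add_one` and `logΓ₂_add_one` lower the
order of each gamma function, and the multiplication formula `sum_logΓ₂_sub_logΓ` collects what is
left. All three compare finite approximations, using Stirling's formula, the asymptotics of the
hyperfactorial, `ζ'(0) = -log (2π) / 2` and `ζ'(-1) = 1/12 - log A`. The last value is derived by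
Euler–Maclaurin summation.

For the integral formula, the ladder turns `(logG)'(s + l/2)` into `(logF)'(s + l/2) - (logF)'(s -
l/2)`. The right side thus becomes the second derivative of `logF` minus its mean over an interval
of length `l` centred at `s`. This operation kills cubic polynomials, so only a series of terms
`invSqDefect` survives (`tendsto_logF_meanDefect`). On the left, `r tanh (π r)` is expanded in
partial fractions and multiplied by the series `φ_s`; every term of the double series is a rational
function with an elementary integral (`hasSum_integral_phi`). Grouping the double series along
antidiagonals (`hasSum_antidiagonal`) gives the same series. -/

namespace HigherSelberg

open Topology

/-! ### Euler–Maclaurin summation for zeta and the value of `ζ'(-1)` -/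

/-- The Euler–Maclaurin approximation of `(1 - s) * ζ s` with `N` terms. -/
noncomputable def zetaApprox (N : ℕ) (s : ℂ) : ℂ :=
  (1 - s) * ∑ k ∈ Finset.range N, ((k : ℂ) + 1) ^ (-s) - (N : ℂ) ^ (1 - s)
    - (1 - s) / 2 * (N : ℂ) ^ (-s) + s * (1 - s) / 12 * (N : ℂ) ^ (-s - 1)

/-- The primitive of `x ↦ (1 - s) * (x - a) ^ 2 * (a + 1 - x) ^ 2 / 24 * f⁗ x`, `f x = x ^ (-s)`,
that integration by parts yields. -/
noncomputable def eulerMaclaurinPrimitive (a s x : ℂ) : ℂ :=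
  (1 - s) * ((x - a) ^ 2 * (a + 1 - x) ^ 2 / 24 * (-s * (s + 1) * (s + 2) * x ^ (-s - 3))
    - (x - a) * (a + 1 - x) * (a + 1 - x - (x - a)) / 12 * (s * (s + 1) * x ^ (-s - 2))
    + (1 - 6 * (x - a) + 6 * (x - a) ^ 2) / 12 * (-s * x ^ (-s - 1))
    - (x - a - 1 / 2) * x ^ (-s)) + x ^ (1 - s)

theorem hasDerivAt_eulerMaclaurinPrimitive (a s : ℂ) {x : ℂ} (hx : x ∈ Complex.slitPlane) :
    HasDerivAt (eulerMaclaurinPrimitive a s)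
      ((1 - s) * ((x - a) ^ 2 * (a + 1 - x) ^ 2 / 24
        * (s * (s + 1) * (s + 2) * (s + 3) * x ^ (-s - 4)))) x := by
  have hp : ∀ c d : ℂ, c - 1 = d → HasDerivAt (fun y : ℂ => y ^ c) (c * x ^ d) x := by
    intro c d h
    have := (hasDerivAt_id x).cpow_const (c := c) hx
    simpa [h] using this
  have h0 := hp (1 - s) (-s) (by ring)
  have h1 := hp (-s) (-s - 1) (by ring)
  have h2 := hp (-s - 1) (-s - 2) (by ring)
  have h3 := hp (-s - 2) (-s - 3) (by ring)
  have h4 := hp (-s - 3) (-s - 4) (by ring)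
  have hu : HasDerivAt (fun y : ℂ => y - a) 1 x := (hasDerivAt_id x).sub_const a
  have hv : HasDerivAt (fun y : ℂ => a + 1 - y) (-1) x := (hasDerivAt_id x).const_sub (a + 1)
  have H := (((((((hu.pow 2).mul (hv.pow 2)).div_const 24).mul
    (h4.const_mul (-s * (s + 1) * (s + 2)))).sub
      ((((hu.mul hv).mul (hv.sub hu)).div_const 12).mul (h3.const_mul (s * (s + 1))))).add
      (((((hu.const_mul 6).const_sub 1).add ((hu.pow 2).const_mul 6)).div_const 12).mul
        (h2.const_mul (-s)))).sub ((hu.sub_const (1 / 2)).mul h1)).const_mul (1 - s) |>.add h0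
  refine (H.congr_deriv ?_)
  simp only [Pi.mul_apply, Pi.pow_apply, Pi.sub_apply, Pi.add_apply]
  push_cast
  ring

/-- On `[a, a + 1]` the kernel `(x - a)² (a + 1 - x)² / 24` and its first derivative vanish at both
ends, its second derivative is `1/12` there, its third is `-1/2` and `1/2`, and its fourth is
constantly `1`. The boundary terms are therefore exactly the correction terms of the approximation.
-/
theorem zetaApprox_succ_sub (N : ℕ) (s : ℂ) :
    zetaApprox (N + 1) s - zetaApprox N s
      = -(eulerMaclaurinPrimitive N s ((N : ℂ) + 1) - eulerMaclaurinPrimitive N s N) := by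
  simp only [zetaApprox, eulerMaclaurinPrimitive, Finset.sum_range_succ]
  push_cast
  ring

/-- The increment is the integral of the kernel against a fourth derivative. The five linear factors
in `s` account for `(3 + R) ^ 5`, and `Re s ≥ -2` leaves a summable `N⁻²`. The point `-1` is
interior to this half plane, so derivatives can be taken there. -/
theorem norm_zetaApprox_succ_sub_le {R : ℝ} {s : ℂ} (hR : ‖s‖ ≤ R) (hs : -2 ≤ s.re) {N : ℕ}
    (hN : 1 ≤ N) :
    ‖zetaApprox (N + 1) s - zetaApprox N s‖ ≤ (3 + R) ^ 5 * (1 / (N : ℝ) ^ 2) := by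
  have hN' : (1 : ℝ) ≤ N := by exact_mod_cast hN
  have hR0 : 0 ≤ R := (norm_nonneg s).trans hR
  rw [zetaApprox_succ_sub, norm_neg]
  have hcast : ∀ t : ℝ, ((N : ℂ) + t) = ((N + t : ℝ) : ℂ) := by intro t; push_cast; ring
  have key := norm_image_sub_le_of_norm_deriv_le_segment_01'
    (f := fun t : ℝ => eulerMaclaurinPrimitive N s ((N : ℂ) + t))
    (f' := fun t : ℝ => (1 - s) * ((((N : ℂ) + t) - N) ^ 2 * ((N : ℂ) + 1 - (N + t)) ^ 2 / 24
        * (s * (s + 1) * (s + 2) * (s + 3) * ((N : ℂ) + t) ^ (-s - 4))))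
    (C := (3 + R) ^ 5 * (1 / (N : ℝ) ^ 2)) ?_ ?_
  · simpa using key
  · intro t ht
    have hm : (N : ℂ) + t ∈ Complex.slitPlane := by
      rw [hcast]; exact Complex.ofReal_mem_slitPlane.2 (by linarith [ht.1])
    have := (hasDerivAt_eulerMaclaurinPrimitive (N : ℂ) s hm).comp (t : ℂ)
      ((hasDerivAt_id (t : ℂ)).const_add (N : ℂ))
    simpa [Function.comp_def] using this.comp_ofReal.hasDerivWithinAt
  · intro t ht
    have ht0 : 0 ≤ t := ht.1
    have ht1 : t ≤ 1 := ht.2.le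
    have hpos : 0 < (N : ℝ) + t := by linarith
    have e1 : ‖((N : ℂ) + t) ^ (-s - 4)‖ ≤ 1 / (N : ℝ) ^ 2 := by
      rw [hcast, Complex.norm_cpow_eq_rpow_re_of_pos hpos]
      calc ((N : ℝ) + t) ^ (-s - 4).re ≤ ((N : ℝ) + t) ^ (-2 : ℝ) := by
            apply Real.rpow_le_rpow_of_exponent_le (by linarith)
            simp; linarith
        _ ≤ (N : ℝ) ^ (-2 : ℝ) := by
            apply Real.rpow_le_rpow_of_nonpos (by linarith) (by linarith) (by norm_num)
        _ = 1 / (N : ℝ) ^ 2 := by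
            rw [Real.rpow_neg (by linarith)]; norm_num
    have e2 : ‖(((N : ℂ) + t) - N) ^ 2 * ((N : ℂ) + 1 - (N + t)) ^ 2 / 24‖ ≤ 1 := by
      have : (((N : ℂ) + t) - N) ^ 2 * ((N : ℂ) + 1 - (N + t)) ^ 2 / 24
          = ((t ^ 2 * (1 - t) ^ 2 / 24 : ℝ) : ℂ) := by push_cast; ring
      rw [this, Complex.norm_of_nonneg (by positivity)]
      have : t ^ 2 ≤ 1 := by nlinarith
      have : (1 - t) ^ 2 ≤ 1 := by nlinarith
      have : t ^ 2 * (1 - t) ^ 2 ≤ 1 := by nlinarith [sq_nonneg t, sq_nonneg (1 - t)]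
      linarith
    have b1 : ‖1 - s‖ ≤ 3 + R := (norm_sub_le _ _).trans (by norm_num; linarith)
    have b2 : ‖s‖ ≤ 3 + R := by linarith
    have b3 : ‖s + 1‖ ≤ 3 + R := (norm_add_le _ _).trans (by norm_num; linarith)
    have b4 : ‖s + 2‖ ≤ 3 + R := (norm_add_le _ _).trans (by norm_num; linarith)
    have b5 : ‖s + 3‖ ≤ 3 + R := (norm_add_le _ _).trans (by norm_num; linarith)
    calc _ = ‖1 - s‖ * (‖(((N : ℂ) + t) - N) ^ 2 * ((N : ℂ) + 1 - (N + t)) ^ 2 / 24‖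
          * (‖s‖ * ‖s + 1‖ * ‖s + 2‖ * ‖s + 3‖ * ‖((N : ℂ) + t) ^ (-s - 4)‖)) := by
            simp only [norm_mul]
      _ ≤ (3 + R) * (1 * ((3 + R) * (3 + R) * (3 + R) * (3 + R) * (1 / (N : ℝ) ^ 2))) := by
            gcongr
      _ = _ := by ring

theorem differentiable_zetaApprox {N : ℕ} (hN : 1 ≤ N) : Differentiable ℂ (zetaApprox N) := by
  have hN0 : (N : ℂ) ≠ 0 := by exact_mod_cast (by omega : N ≠ 0)
  have h : ∀ k : ℕ, (k : ℂ) + 1 ≠ 0 := fun k => Nat.cast_add_one_ne_zero k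
  unfold zetaApprox
  refine Differentiable.add (Differentiable.sub (Differentiable.sub (Differentiable.mul ?_ ?_) ?_)
    ?_) ?_
  · fun_prop
  · refine Differentiable.fun_sum fun k _ => ?_
    exact Differentiable.const_cpow (by fun_prop) (Or.inl (h k))
  · exact Differentiable.const_cpow (by fun_prop) (Or.inl hN0)
  · exact Differentiable.mul (by fun_prop) (Differentiable.const_cpow (by fun_prop) (Or.inl hN0))
  · exact Differentiable.mul (by fun_prop) (Differentiable.const_cpow (by fun_prop) (Or.inl hN0))

theorem tendsto_zetaApprox_of_one_lt_re {s : ℂ} (hs : 1 < s.re) :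
    Tendsto (fun N => zetaApprox (N + 1) s) atTop (𝓝 (-riemannZeta₁ s)) := by
  have hs1 : s ≠ 1 := by rintro rfl; simp at hs
  have hsum : Tendsto (fun N : ℕ => ∑ k ∈ Finset.range (N + 1), ((k : ℂ) + 1) ^ (-s)) atTop
      (𝓝 (riemannZeta s)) := by
    rw [zeta_eq_tsum_one_div_nat_add_one_cpow hs]
    have hS : Summable fun n : ℕ => 1 / ((n : ℂ) + 1) ^ s := by
      have := (summable_nat_add_iff 1).2 (Complex.summable_one_div_nat_cpow.2 hs)
      simpa using this
    have := (tendsto_add_atTop_iff_nat 1).2 hS.hasSum.tendsto_sum_nat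
    refine this.congr fun N => Finset.sum_congr rfl fun k _ => ?_
    rw [Complex.cpow_neg, one_div]
  have hz : ∀ c : ℂ, c.re < 0 → Tendsto (fun N : ℕ => ((N + 1 : ℕ) : ℂ) ^ c) atTop (𝓝 0) := by
    intro c hc
    rw [tendsto_zero_iff_norm_tendsto_zero]
    have h1 : Tendsto (fun N : ℕ => ((N + 1 : ℕ) : ℝ) ^ c.re) atTop (𝓝 0) := by
      have := tendsto_rpow_neg_atTop (y := -c.re) (by linarith)
      simp only [neg_neg] at this
      exact this.comp (tendsto_natCast_atTop_atTop.comp (tendsto_add_atTop_nat 1))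
    refine h1.congr fun N => ?_
    rw [Complex.norm_natCast_cpow_of_pos (by omega)]
  have := (((hsum.const_mul (1 - s)).sub (hz (1 - s) (by simp; linarith))).sub
    ((hz (-s) (by simp; linarith)).const_mul ((1 - s) / 2))).add
    ((hz (-s - 1) (by simp; linarith)).const_mul (s * (1 - s) / 12))
  have e : -riemannZeta₁ s = (1 - s) * riemannZeta s - 0 - (1 - s) / 2 * 0
      + s * (1 - s) / 12 * 0 := by
    have : s - 1 ≠ 0 := sub_ne_zero.2 hs1
    rw [riemannZeta_eq_inv_sub_mul hs1]
    field_simp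
    ring
  rw [e]
  exact this

/-- The telescoping series converges uniformly on compact sets, so its limit is holomorphic on `Re s
> -2`. It agrees with the entire function `-riemannZeta₁` where the Dirichlet series converges,
hence everywhere by the identity theorem. -/
theorem tendstoLocallyUniformlyOn_zetaApprox :
    TendstoLocallyUniformlyOn (fun N s => zetaApprox (N + 1) s) (fun s => -riemannZeta₁ s) atTop
      {s : ℂ | -2 < s.re} := by
  set U := {s : ℂ | -2 < s.re}
  have hU : IsOpen U := isOpen_lt continuous_const Complex.continuous_re
  set D : ℕ → ℂ → ℂ := fun n s => zetaApprox (n + 1 + 1) s - zetaApprox (n + 1) s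
  set g : ℂ → ℂ := fun s => zetaApprox 1 s + ∑' n, D n s
  have hpart : ∀ N s, zetaApprox (N + 1) s = zetaApprox 1 s + ∑ n ∈ Finset.range N, D n s := by
    intro N s
    rw [Finset.sum_range_sub (fun n => zetaApprox (n + 1) s)]
    ring
  have hlim : TendstoLocallyUniformlyOn (fun N s => zetaApprox (N + 1) s) g atTop U := by
    rw [tendstoLocallyUniformlyOn_iff_forall_isCompact hU]
    intro K hKU hK
    obtain ⟨R, hR⟩ := hK.isBounded.exists_norm_le
    have hu : Summable fun n : ℕ => (3 + R) ^ 5 * (1 / ((n + 1 : ℕ) : ℝ) ^ 2) :=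
      ((summable_nat_add_iff 1).2 (Real.summable_one_div_nat_pow.2 one_lt_two)).mul_left _
    have := tendstoUniformlyOn_tsum_nat hu (s := K) (f := D) fun n s hs =>
      norm_zetaApprox_succ_sub_le (hR s hs) (hKU hs : -2 < s.re).le (by omega)
    rw [Metric.tendstoUniformlyOn_iff] at this ⊢
    intro ε hε
    filter_upwards [this ε hε] with N hN s hs
    rw [hpart, dist_add_left]
    exact hN s hs
  have hgd : DifferentiableOn ℂ g U := hlim.differentiableOn
    (Eventually.of_forall fun N => (differentiable_zetaApprox (by omega)).differentiableOn) hU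
  have heq : Set.EqOn g (fun s => -riemannZeta₁ s) U := by
    refine (hgd.analyticOnNhd hU).eqOn_of_preconnected_of_eventuallyEq
      ((differentiable_riemannZeta₁.neg.differentiableOn).analyticOnNhd hU)
      (convex_halfSpace_re_gt (-2)).isPreconnected (z₀ := 2) (by simp [U]) ?_
    have : {s : ℂ | 1 < s.re} ∈ 𝓝 (2 : ℂ) :=
      (isOpen_lt continuous_const Complex.continuous_re).mem_nhds (by simp)
    filter_upwards [this] with s hs
    have hsU : s ∈ U := by simp only [U, Set.mem_ofPred_eq] at *; linarith
    exact tendsto_nhds_unique (hlim.tendsto_at hsU) (tendsto_zetaApprox_of_one_lt_re hs)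
  exact hlim.congr_right heq

/-- The sequence whose limit is `log A`. -/
noncomputable def glaisherSeq (N : ℕ) : ℝ :=
  ∑ k ∈ Finset.Icc 1 N, (k : ℝ) * Real.log k
      - ((N : ℝ) ^ 2 / 2 + (N : ℝ) / 2 + 1 / 12) * Real.log N + (N : ℝ) ^ 2 / 4

/-- Differentiating `k ^ (-s)` at `-1` produces `-k log k`, which is how the hyperfactorial enters.
-/
theorem deriv_zetaApprox_neg_one {N : ℕ} (hN : 1 ≤ N) :
    deriv (zetaApprox N) (-1) = -2 * (glaisherSeq N : ℂ) + 1 / 4 := by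
  have hN0 : (N : ℂ) ≠ 0 := by exact_mod_cast (by omega : N ≠ 0)
  have hp : ∀ (a : ℂ) (f : ℂ → ℂ) (f' : ℂ), a ≠ 0 → HasDerivAt f f' (-1) →
      HasDerivAt (fun s => a ^ f s) (a ^ f (-1) * Complex.log a * f') (-1) :=
    fun a f f' ha hf => hf.const_cpow (Or.inl ha)
  have hid := hasDerivAt_id (-1 : ℂ)
  have h1s : HasDerivAt (fun s : ℂ => 1 - s) (-1) (-1) := hid.const_sub 1
  have hns : HasDerivAt (fun s : ℂ => -s) (-1) (-1) := hid.neg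
  have hns1 : HasDerivAt (fun s : ℂ => -s - 1) (-1) (-1) := hns.sub_const 1
  have hsum : HasDerivAt (fun s : ℂ => ∑ k ∈ Finset.range N, ((k : ℂ) + 1) ^ (-s))
      (∑ k ∈ Finset.range N, ((k : ℂ) + 1) ^ (-(-1 : ℂ)) * Complex.log ((k : ℂ) + 1) * (-1)) (-1) :=
    HasDerivAt.fun_sum fun k _ => hp _ _ _ (Nat.cast_add_one_ne_zero k) hns
  have H := (((h1s.mul hsum).sub (hp _ _ _ hN0 h1s)).sub
    ((h1s.div_const 2).mul (hp _ _ _ hN0 hns))).add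
    (((hid.mul h1s).div_const 12).mul (hp _ _ _ hN0 hns1))
  have H' : HasDerivAt (zetaApprox N) _ (-1) := H
  rw [H'.deriv]
  have hs1 : ∑ k ∈ Finset.range N, ((k : ℂ) + 1) = (N : ℂ) * (N + 1) / 2 := by
    clear * -
    induction N with
    | zero => simp
    | succ n ih => rw [Finset.sum_range_succ, ih]; push_cast; ring
  have hs2 : ∑ k ∈ Finset.range N, ((k : ℂ) + 1) * Complex.log ((k : ℂ) + 1)
      = ((∑ k ∈ Finset.Icc 1 N, (k : ℝ) * Real.log k : ℝ) : ℂ) := by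
    rw [Finset.range_eq_Ico, Finset.sum_Ico_add' (fun k : ℕ => (k : ℝ) * Real.log k) 0 N 1 |>.symm
      |> fun h => (show (∑ k ∈ Finset.Icc 1 N, (k : ℝ) * Real.log k) = _ from h)]
    push_cast
    refine Finset.sum_congr rfl fun k _ => ?_
    rw [Complex.ofReal_log (by positivity)]
    push_cast
    rfl
  have hl : Complex.log N = ((Real.log N : ℝ) : ℂ) := by
    rw [Complex.ofReal_log (by positivity)]; simp
  have e2 : (N : ℂ) ^ (1 - (-1) : ℂ) = (N : ℂ) ^ 2 := by
    rw [show (1 - (-1) : ℂ) = ((2 : ℕ) : ℂ) by norm_num, Complex.cpow_natCast]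
  simp only [Pi.mul_apply, id, e2, neg_neg, sub_self, Complex.cpow_zero, Complex.cpow_one, hs1, ← Finset.sum_mul, hs2, hl,
    glaisherSeq]
  push_cast
  ring

/-- Locally uniform limits of holomorphic functions may be differentiated. The derivative of `(1 -
s) ζ(s)` at `-1` is `-ζ(-1) + 2 ζ'(-1)`, with `ζ(-1) = -1/12`. -/
theorem tendsto_glaisherSeq_aux :
    Tendsto (fun N => (glaisherSeq (N + 1) : ℂ)) atTop
      (𝓝 (1 / 12 - deriv riemannZeta (-1))) := by
  have hU : IsOpen {s : ℂ | -2 < s.re} := isOpen_lt continuous_const Complex.continuous_re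
  have h := (tendstoLocallyUniformlyOn_zetaApprox.deriv (Eventually.of_forall fun N =>
    (differentiable_zetaApprox (by omega)).differentiableOn) hU).tendsto_at
      (show (-1 : ℂ) ∈ {s : ℂ | -2 < s.re} by simp)
  have hz : deriv (fun s => -riemannZeta₁ s) (-1)
      = 1 / 12 + 2 * deriv riemannZeta (-1) := by
    have h1 : (fun s => -riemannZeta₁ s) =ᶠ[𝓝 (-1 : ℂ)] fun s => (1 - s) * riemannZeta s := by
      filter_upwards [isOpen_ne.mem_nhds (show (-1 : ℂ) ≠ 1 by norm_num)] with s hs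
      have : s - 1 ≠ 0 := sub_ne_zero.2 hs
      rw [riemannZeta_eq_inv_sub_mul hs]
      field_simp
      ring
    rw [h1.deriv_eq]
    have hd := (differentiableAt_riemannZeta (s := -1) (by norm_num)).hasDerivAt
    have := ((hasDerivAt_id (-1 : ℂ)).const_sub 1).mul hd
    have hzeta : riemannZeta (-1) = -1 / 12 := by
      have := riemannZeta_neg_nat_eq_bernoulli 1
      norm_num [bernoulli_two] at this
      rw [this]; norm_num
    have e := this.deriv
    simp only [id, hzeta] at e
    refine Eq.trans ?_ (e.trans ?_)
    · rfl
    · ring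
  rw [hz] at h
  have h2 := (h.sub_const (1 / 4 : ℂ)).div_const (-2)
  have e : (1 / 12 + 2 * deriv riemannZeta (-1) - 1 / 4) / -2
      = 1 / 12 - deriv riemannZeta (-1) := by ring
  rw [e] at h2
  refine h2.congr fun N => ?_
  simp only [Function.comp]
  rw [deriv_zetaApprox_neg_one (by omega)]
  ring

/-- `glaisher` is defined through `limUnder`, which is meaningful only once convergence is known. -/
theorem exists_tendsto_glaisherSeq : ∃ a : ℝ, Tendsto glaisherSeq atTop (𝓝 a) := by
  refine ⟨(1 / 12 - deriv riemannZeta (-1)).re, (tendsto_add_atTop_iff_nat 1).1 ?_⟩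
  exact (Complex.continuous_re.tendsto _).comp tendsto_glaisherSeq_aux

theorem tendsto_glaisherSeq : Tendsto glaisherSeq atTop (𝓝 (Real.log glaisher)) := by
  obtain ⟨a, ha⟩ := exists_tendsto_glaisherSeq
  have : glaisher = Real.exp a := congrArg Real.exp ha.limUnder_eq
  rwa [this, Real.log_exp]

theorem deriv_riemannZeta_neg_one :
    deriv riemannZeta (-1) = 1 / 12 - (Real.log glaisher : ℂ) := by
  have h1 := (Complex.continuous_ofReal.tendsto _).comp
    ((tendsto_add_atTop_iff_nat 1).2 tendsto_glaisherSeq)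
  have := tendsto_nhds_unique tendsto_glaisherSeq_aux h1
  rw [← this]
  ring

theorem glaisher_pos : 0 < glaisher := Real.exp_pos _

/-! ### Logarithms of the Weierstrass products on the right half plane -/

theorem re_pos_isOpen : IsOpen {w : ℂ | 0 < w.re} := isOpen_lt continuous_const Complex.continuous_re

/-- The difference has derivative `(-z) ^ m / (1 + z)`, and `Re (1 + z) ≥ δ` along the whole segment
from `0` to `x` because this holds at both ends. No smallness of `x` is needed, so all terms of the
series are covered uniformly. -/
theorem norm_log_one_add_sub_logTaylor_le (m : ℕ) {δ : ℝ} (hδ : 0 < δ) (hδ1 : δ ≤ 1) {x : ℂ}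
    (hx : δ ≤ 1 + x.re) :
    ‖Complex.log (1 + x) - Complex.logTaylor (m + 1) x‖ ≤ ‖x‖ ^ (m + 1) / δ := by
  have hre : ∀ t : ℝ, 0 ≤ t → t ≤ 1 → δ ≤ (1 + t * x).re := by
    intro t h0 h1
    simp only [Complex.add_re, Complex.one_re, Complex.re_ofReal_mul]
    nlinarith
  have key := norm_image_sub_le_of_norm_deriv_le_segment_01'
    (f := fun t : ℝ => Complex.log (1 + t * x) - Complex.logTaylor (m + 1) (t * x))
    (f' := fun t : ℝ => (-(t * x)) ^ m * (1 + t * x)⁻¹ * x)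
    (C := ‖x‖ ^ (m + 1) / δ) ?_ ?_
  · simpa [Complex.logTaylor_at_zero] using key
  · intro t ht
    have hm : 1 + t * x ∈ Complex.slitPlane := Or.inl (hδ.trans_le (hre t ht.1 ht.2))
    have := (Complex.hasDerivAt_log_sub_logTaylor m hm).comp (t : ℂ)
      ((hasDerivAt_id (t : ℂ)).mul_const x)
    simpa [Function.comp_def] using this.comp_ofReal.hasDerivWithinAt
  · intro t ht
    have h1 := hre t ht.1 ht.2.le
    have h2 : ‖(1 + t * x)⁻¹‖ ≤ 1 / δ := by
      rw [norm_inv, one_div]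
      exact inv_anti₀ hδ (h1.trans (Complex.re_le_norm _))
    have h3 : ‖(t * x)‖ ≤ ‖x‖ := by
      rw [norm_mul, Complex.norm_of_nonneg ht.1]
      exact mul_le_of_le_one_left (norm_nonneg _) ht.2.le
    calc _ = ‖(t * x)‖ ^ m * ‖(1 + t * x)⁻¹‖ * ‖x‖ := by simp only [norm_mul, norm_pow, norm_neg]
      _ ≤ ‖x‖ ^ m * (1 / δ) * ‖x‖ := by gcongr
      _ = _ := by ring

/-- Weierstrass' test for series of functions of `w` that are `O(n⁻²)`, uniformly on the sets
`δ ≤ Re w`, `‖w - 1‖ ≤ R`. -/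
theorem tendstoLocallyUniformlyOn_tsum_of_bound {f : ℕ → ℂ → ℂ}
    (h : ∀ δ R : ℝ, 0 < δ → δ ≤ 1 → ∃ C : ℝ, ∀ n w, δ ≤ w.re → ‖w - 1‖ ≤ R →
      ‖f n w‖ ≤ C * (1 / ((n + 1 : ℕ) : ℝ) ^ 2)) :
    (∀ w : ℂ, 0 < w.re → Summable fun n => f n w) ∧
    TendstoLocallyUniformlyOn (fun N w => ∑ n ∈ Finset.range N, f n w) (fun w => ∑' n, f n w)
      atTop {w : ℂ | 0 < w.re} := by
  have hu : ∀ C : ℝ, Summable fun n : ℕ => C * (1 / ((n + 1 : ℕ) : ℝ) ^ 2) := fun C =>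
    ((summable_nat_add_iff 1).2 (Real.summable_one_div_nat_pow.2 one_lt_two)).mul_left _
  constructor
  · intro w hw
    obtain ⟨C, hC⟩ := h (min w.re 1) ‖w - 1‖ (lt_min hw one_pos) (min_le_right _ _)
    exact Summable.of_norm_bounded (hu C) fun n => hC n w (min_le_left _ _) le_rfl
  · rw [tendstoLocallyUniformlyOn_iff_forall_isCompact re_pos_isOpen]
    intro K hKU hK
    obtain ⟨R, hR⟩ := hK.isBounded.exists_norm_le
    obtain ⟨δ, hδ, hδK⟩ : ∃ δ : ℝ, 0 < δ ∧ ∀ w ∈ K, δ ≤ w.re := by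
      rcases K.eq_empty_or_nonempty with rfl | hne
      · exact ⟨1, one_pos, by simp⟩
      · obtain ⟨w₀, hw₀, hmin⟩ := hK.exists_isMinOn hne Complex.continuous_re.continuousOn
        exact ⟨w₀.re, hKU hw₀, fun w hw => hmin hw⟩
    obtain ⟨C, hC⟩ := h (min δ 1) (R + 1) (lt_min hδ one_pos) (min_le_right _ _)
    refine tendstoUniformlyOn_tsum_nat (hu C) fun n w hw => hC n w ?_ ?_
    · exact (min_le_left _ _).trans (hδK w hw)
    · exact (norm_sub_le _ _).trans (by simpa using hR w hw)

/-- `log (1 + z) - ∑_{1 ≤ j ≤ m} (-1) ^ (j + 1) * z ^ j / j` at `z = (w - 1) / (n + 1)`. -/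
noncomputable def logRem (m n : ℕ) (w : ℂ) : ℂ :=
  Complex.log (1 + (w - 1) / (n + 1)) - Complex.logTaylor (m + 1) ((w - 1) / (n + 1))

theorem norm_logRem_le (m n : ℕ) {δ R : ℝ} (hδ : 0 < δ) (hδ1 : δ ≤ 1) {w : ℂ} (hw : δ ≤ w.re)
    (hR : ‖w - 1‖ ≤ R) :
    ‖logRem m n w‖ ≤ R ^ (m + 1) / δ * (1 / ((n + 1 : ℕ) : ℝ) ^ (m + 1)) := by
  have hn : (1 : ℝ) ≤ n + 1 := by norm_cast; omega
  -- `1 + (w - 1) / (n + 1)` is a convex combination of `1` and `w`, whose real parts are both at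
  -- least `δ`.
  have hre : δ ≤ 1 + ((w - 1) / (n + 1)).re := by
    have : ((w - 1) / (n + 1)).re = (w.re - 1) / (n + 1) := by
      have : (n : ℂ) + 1 = ((n + 1 : ℝ) : ℂ) := by push_cast; ring
      rw [this, Complex.div_ofReal_re]; simp
    rw [this]
    have : δ - 1 ≤ (w.re - 1) / (n + 1) := by
      rw [le_div_iff₀ (by linarith)]
      nlinarith
    linarith
  refine (norm_log_one_add_sub_logTaylor_le m hδ hδ1 hre).trans ?_
  have : ‖(w - 1) / (n + 1)‖ ≤ R / (n + 1) := by
    have e : ‖(n : ℂ) + 1‖ = n + 1 := by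
      have : (n : ℂ) + 1 = ((n + 1 : ℝ) : ℂ) := by push_cast; ring
      rw [this, Complex.norm_of_nonneg (by positivity)]
    rw [norm_div, e]
    gcongr
  calc _ ≤ (R / (n + 1)) ^ (m + 1) / δ := by gcongr
    _ = _ := by
      push_cast
      rw [div_pow]
      field_simp

/-- Only a positive real factor is split off, so the principal branch is respected. -/
theorem log_one_add_div (n : ℕ) {w : ℂ} (hw : 0 < w.re) :
    Complex.log (1 + (w - 1) / (n + 1)) = Complex.log (w + n) - (Real.log (n + 1) : ℝ) := by
  have hn : (0 : ℝ) < n + 1 := by positivity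
  have hne : (n : ℂ) + 1 ≠ 0 := Nat.cast_add_one_ne_zero n
  have hne' : w + n ≠ 0 := by
    intro h
    have := congrArg Complex.re h
    simp at this
    linarith [(Nat.cast_nonneg n : (0 : ℝ) ≤ n)]
  have : 1 + (w - 1) / (n + 1) = (((n + 1 : ℝ)⁻¹ : ℝ) : ℂ) * (w + n) := by
    push_cast
    field_simp
    ring
  rw [this, Complex.log_ofReal_mul (by positivity) hne', Real.log_inv]
  push_cast
  ring

/-- The logarithm of `Γ` on the right half plane, by Weierstrass' product. -/
noncomputable def logΓ (w : ℂ) : ℂ :=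
  -(Real.eulerMascheroniConstant : ℂ) * (w - 1) - ∑' n, logRem 1 n w

/-- The logarithm of `Γ₂` on the right half plane. -/
noncomputable def logΓ₂ (w : ℂ) : ℂ :=
  (1 / 2 + (Real.eulerMascheroniConstant : ℂ) / 2) * (w - 1) ^ 2
      + (1 / 2 + deriv riemannZeta 0) * (w - 1) - ∑' n : ℕ, ((n : ℂ) + 1) * logRem 2 n w

/-- The logarithm of `Γ₃` on the right half plane. -/
noncomputable def logΓ₃ (w : ℂ) : ℂ :=
  (-1 / 4 - (Real.eulerMascheroniConstant : ℂ) / 6) * (w - 1) ^ 3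
      + (1 / 8 - deriv riemannZeta 0 / 2 + (Real.eulerMascheroniConstant : ℂ) / 4) * (w - 1) ^ 2
      + (7 / 24 + deriv riemannZeta (-1) + deriv riemannZeta 0 / 2) * (w - 1)
    - ∑' n : ℕ, (((n : ℂ) + 1) * (n + 2) / 2 * logRem 3 n w + (w - 1) ^ 3 / (6 * (n + 1) ^ 2))

theorem norm_natCast_add_one (n : ℕ) : ‖(n : ℂ) + 1‖ = n + 1 := by
  have : (n : ℂ) + 1 = ((n + 1 : ℝ) : ℂ) := by push_cast; ring
  rw [this, Complex.norm_of_nonneg (by positivity)]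

theorem logΓ_series :
    (∀ w : ℂ, 0 < w.re → Summable fun n : ℕ => logRem 1 n w) ∧
    TendstoLocallyUniformlyOn (fun N w => ∑ n ∈ Finset.range N, logRem 1 n w)
      (fun w => ∑' n : ℕ, logRem 1 n w)
      atTop {w : ℂ | 0 < w.re} :=
  tendstoLocallyUniformlyOn_tsum_of_bound
  fun δ R hδ hδ1 => ⟨R ^ 2 / δ, fun n _ hw hR => norm_logRem_le 1 n hδ hδ1 hw hR⟩

theorem logΓ₂_series :
    (∀ w : ℂ, 0 < w.re → Summable fun n : ℕ => ((n : ℂ) + 1) * logRem 2 n w) ∧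
    TendstoLocallyUniformlyOn (fun N w => ∑ n ∈ Finset.range N, ((n : ℂ) + 1) * logRem 2 n w)
      (fun w => ∑' n : ℕ, ((n : ℂ) + 1) * logRem 2 n w)
      atTop {w : ℂ | 0 < w.re} :=
  tendstoLocallyUniformlyOn_tsum_of_bound
  fun δ R hδ hδ1 => ⟨R ^ 3 / δ, fun n w hw hR => by
    have h := norm_logRem_le 2 n hδ hδ1 hw hR
    rw [norm_mul, norm_natCast_add_one]
    calc _ ≤ ((n : ℝ) + 1) * (R ^ (2 + 1) / δ * (1 / ((n + 1 : ℕ) : ℝ) ^ (2 + 1))) := by gcongr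
      _ = _ := by push_cast; field_simp⟩

/-- With `k = n + 1`, the full Taylor correction of order three is `k (k + 1) / 2 · z³ / (3 k³) = z³
/ (6 k) + z³ / (6 k²)`, whereas the product carries only `z³ / (6 k)`. The additional summand
restores the difference and is itself `O(k⁻²)`. -/
theorem logΓ₃_series :
    (∀ w : ℂ, 0 < w.re → Summable fun n : ℕ => (((n : ℂ) + 1) * (n + 2) / 2 * logRem 3 n w
      + (w - 1) ^ 3 / (6 * (n + 1) ^ 2))) ∧
    TendstoLocallyUniformlyOn (fun N w => ∑ n ∈ Finset.range N, (((n : ℂ) + 1) * (n + 2) / 2 * logRem 3 n w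
      + (w - 1) ^ 3 / (6 * (n + 1) ^ 2)))
      (fun w => ∑' n : ℕ, (((n : ℂ) + 1) * (n + 2) / 2 * logRem 3 n w
      + (w - 1) ^ 3 / (6 * (n + 1) ^ 2)))
      atTop {w : ℂ | 0 < w.re} :=
  tendstoLocallyUniformlyOn_tsum_of_bound
  fun δ R hδ hδ1 => ⟨R ^ 4 / δ + R ^ 3, fun n w hw hR => by
    have h := norm_logRem_le 3 n hδ hδ1 hw hR
    have hR0 : 0 ≤ R := (norm_nonneg _).trans hR
    have e2 : ‖(n : ℂ) + 2‖ ≤ 2 * (n + 1) := by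
      have : (n : ℂ) + 2 = ((n + 2 : ℝ) : ℂ) := by push_cast; ring
      rw [this, Complex.norm_of_nonneg (by positivity)]
      linarith [(Nat.cast_nonneg n : (0 : ℝ) ≤ n)]
    calc _ ≤ ‖(n : ℂ) + 1‖ * ‖(n : ℂ) + 2‖ / 2 * ‖logRem 3 n w‖
          + ‖w - 1‖ ^ 3 / (6 * ‖(n : ℂ) + 1‖ ^ 2) := by
            refine (norm_add_le _ _).trans (le_of_eq ?_)
            simp only [norm_mul, norm_div, norm_pow, Complex.norm_ofNat]
      _ ≤ (n + 1) * (2 * (n + 1)) / 2 * (R ^ (3 + 1) / δ * (1 / ((n + 1 : ℕ) : ℝ) ^ (3 + 1)))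
          + R ^ 3 / (1 * (n + 1) ^ 2) := by
            rw [norm_natCast_add_one]
            gcongr
            norm_num
      _ = _ := by push_cast; field_simp⟩

/-- `∑_{k ≤ N} 1 / k`. -/
noncomputable def harm (N : ℕ) : ℂ := ∑ n ∈ Finset.range N, 1 / ((n : ℂ) + 1)

/-- The logarithm of the `N`-th partial Weierstrass product of `Γ`. -/
noncomputable def logΓApprox (N : ℕ) (w : ℂ) : ℂ :=
  (harm N - Real.eulerMascheroniConstant) * (w - 1)
    - ∑ n ∈ Finset.range N, (Complex.log (w + n) - (Real.log (n + 1) : ℝ))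

/-- The logarithm of the `N`-th partial Weierstrass product of `Γ₂`. -/
noncomputable def logΓ₂Approx (N : ℕ) (w : ℂ) : ℂ :=
  (1 / 2 + Real.eulerMascheroniConstant / 2 - harm N / 2) * (w - 1) ^ 2
    + (1 / 2 + deriv riemannZeta 0 + N) * (w - 1)
    - ∑ n ∈ Finset.range N, ((n : ℂ) + 1) * (Complex.log (w + n) - (Real.log (n + 1) : ℝ))

/-- The logarithm of the `N`-th partial Weierstrass product of `Γ₃`. -/
noncomputable def logΓ₃Approx (N : ℕ) (w : ℂ) : ℂ :=
  (-1 / 4 - Real.eulerMascheroniConstant / 6 + harm N / 6) * (w - 1) ^ 3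
    + (1 / 8 - deriv riemannZeta 0 / 2 + Real.eulerMascheroniConstant / 4 - N / 4 - harm N / 4)
      * (w - 1) ^ 2
    + (7 / 24 + deriv riemannZeta (-1) + deriv riemannZeta 0 / 2 + N / 2 + N * (N + 1) / 4)
      * (w - 1)
    - ∑ n ∈ Finset.range N, ((n : ℂ) + 1) * (n + 2) / 2
      * (Complex.log (w + n) - (Real.log (n + 1) : ℝ))

/-- Summing the Taylor terms separately makes the convergence factors into a polynomial whose
coefficients involve `harm N`; the bare logarithms that remain can be telescoped. The same
separation is used for `Γ₂` and `Γ₃`. -/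
theorem logΓApprox_eq (N : ℕ) {w : ℂ} (hw : 0 < w.re) :
    logΓApprox N w = -(Real.eulerMascheroniConstant : ℂ) * (w - 1)
      - ∑ n ∈ Finset.range N, logRem 1 n w := by
  simp only [logΓApprox, logRem, log_one_add_div _ hw, harm, Complex.logTaylor,
    Finset.sum_range_succ, Finset.sum_range_zero]
  induction N with
  | zero => simp
  | succ N ih =>
    have hne : (N : ℂ) + 1 ≠ 0 := Nat.cast_add_one_ne_zero N
    simp only [Finset.sum_range_succ]
    push_cast at ih ⊢
    linear_combination ih

theorem logΓ₂Approx_eq (N : ℕ) {w : ℂ} (hw : 0 < w.re) :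
    logΓ₂Approx N w = (1 / 2 + (Real.eulerMascheroniConstant : ℂ) / 2) * (w - 1) ^ 2
      + (1 / 2 + deriv riemannZeta 0) * (w - 1)
      - ∑ n ∈ Finset.range N, ((n : ℂ) + 1) * logRem 2 n w := by
  simp only [logΓ₂Approx, logRem, log_one_add_div _ hw, harm, Complex.logTaylor,
    Finset.sum_range_succ, Finset.sum_range_zero]
  induction N with
  | zero => simp
  | succ N ih =>
    have hne : (N : ℂ) + 1 ≠ 0 := Nat.cast_add_one_ne_zero N
    simp only [Finset.sum_range_succ]
    push_cast at ih ⊢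
    linear_combination ih + (by field_simp : (w - 1) - 1 / (N + 1) / 2 * (w - 1) ^ 2
      = (N + 1) * ((w - 1) / (N + 1) - ((w - 1) / (N + 1)) ^ 2 / 2))

theorem logΓ₃Approx_eq (N : ℕ) {w : ℂ} (hw : 0 < w.re) :
    logΓ₃Approx N w = (-1 / 4 - (Real.eulerMascheroniConstant : ℂ) / 6) * (w - 1) ^ 3
      + (1 / 8 - deriv riemannZeta 0 / 2 + (Real.eulerMascheroniConstant : ℂ) / 4) * (w - 1) ^ 2
      + (7 / 24 + deriv riemannZeta (-1) + deriv riemannZeta 0 / 2) * (w - 1)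
      - ∑ n ∈ Finset.range N, (((n : ℂ) + 1) * (n + 2) / 2 * logRem 3 n w
        + (w - 1) ^ 3 / (6 * (n + 1) ^ 2)) := by
  simp only [logΓ₃Approx, logRem, log_one_add_div _ hw, harm, Complex.logTaylor,
    Finset.sum_range_succ, Finset.sum_range_zero]
  induction N with
  | zero => simp
  | succ N ih =>
    have hne : (N : ℂ) + 1 ≠ 0 := Nat.cast_add_one_ne_zero N
    simp only [Finset.sum_range_succ]
    push_cast at ih ⊢
    linear_combination ih +
      (by field_simp; ring : 1 / (N + 1) / 6 * (w - 1) ^ 3 - (1 / 4 + 1 / (N + 1) / 4) * (w - 1) ^ 2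
        + (1 / 2 + (N + 1) / 2) * (w - 1)
      = ((N : ℂ) + 1) * (N + 2) / 2 * ((w - 1) / (N + 1) - ((w - 1) / (N + 1)) ^ 2 / 2
        + ((w - 1) / (N + 1)) ^ 3 / 3) - (w - 1) ^ 3 / (6 * (N + 1) ^ 2))

theorem tendstoLocallyUniformlyOn_of_eq_sub_sum {F : ℕ → ℂ → ℂ} {P S : ℂ → ℂ} {f : ℕ → ℂ → ℂ}
    {U : Set ℂ}
    (hF : ∀ N, ∀ w ∈ U, F N w = P w - ∑ n ∈ Finset.range N, f n w)
    (h : TendstoLocallyUniformlyOn (fun N w => ∑ n ∈ Finset.range N, f n w) S atTop U) :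
    TendstoLocallyUniformlyOn F (fun w => P w - S w) atTop U := by
  rw [Metric.tendstoLocallyUniformlyOn_iff] at h ⊢
  intro ε hε x hx
  obtain ⟨t, ht, H⟩ := h ε hε x hx
  refine ⟨t ∩ U, inter_mem ht self_mem_nhdsWithin, H.mono fun N hN w hw => ?_⟩
  rw [hF N w hw.2, dist_sub_left]
  exact hN w hw.1

theorem tendstoLocallyUniformlyOn_logΓApprox :
    TendstoLocallyUniformlyOn logΓApprox logΓ atTop {w : ℂ | 0 < w.re} :=
  tendstoLocallyUniformlyOn_of_eq_sub_sum (fun N _ hw => logΓApprox_eq N hw) logΓ_series.2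

theorem tendstoLocallyUniformlyOn_logΓ₂Approx :
    TendstoLocallyUniformlyOn logΓ₂Approx logΓ₂ atTop {w : ℂ | 0 < w.re} :=
  tendstoLocallyUniformlyOn_of_eq_sub_sum (fun N _ hw => logΓ₂Approx_eq N hw) logΓ₂_series.2

theorem tendstoLocallyUniformlyOn_logΓ₃Approx :
    TendstoLocallyUniformlyOn logΓ₃Approx logΓ₃ atTop {w : ℂ | 0 < w.re} :=
  tendstoLocallyUniformlyOn_of_eq_sub_sum (fun N _ hw => logΓ₃Approx_eq N hw) logΓ₃_series.2

theorem one_add_div_ne_zero (n : ℕ) {w : ℂ} (hw : 0 < w.re) : 1 + (w - 1) / ((n : ℂ) + 1) ≠ 0 := by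
  intro h
  have hne : (n : ℂ) + 1 ≠ 0 := Nat.cast_add_one_ne_zero n
  field_simp at h
  have := congrArg Complex.re h
  simp at this
  linarith [(Nat.cast_nonneg n : (0 : ℝ) ≤ n)]

/-- The exponential maps the convergent sum to the convergent product. The multiplicities are
integers, so no choice of branch survives. -/
theorem exp_logΓ₂ {w : ℂ} (hw : 0 < w.re) : Complex.exp (logΓ₂ w) = Gamma₂ w := by
  have h := (logΓ₂_series.1 w hw).hasSum.cexp
  have e : (Complex.exp ∘ fun n : ℕ => ((n : ℂ) + 1) * logRem 2 n w)
      = fun n : ℕ => (1 + (w - 1) / (n + 1)) ^ (n + 1)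
        * Complex.exp (-(w - 1) + (w - 1) ^ 2 / (2 * (n + 1))) := by
    funext n
    have hne : (n : ℂ) + 1 ≠ 0 := Nat.cast_add_one_ne_zero n
    rw [← Complex.exp_log (one_add_div_ne_zero n hw), ← Complex.exp_nat_mul, ← Complex.exp_add]
    simp only [Function.comp, logRem, Complex.logTaylor, Finset.sum_range_succ,
      Finset.sum_range_zero]
    congr 1
    generalize Complex.log (1 + (w - 1) / (n + 1)) = L
    push_cast
    field_simp
    ring
  rw [e] at h
  rw [Gamma₂, h.tprod_eq, ← Complex.exp_add, ← Complex.exp_neg, logΓ₂]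
  congr 1
  ring

theorem exp_logΓ₃ {w : ℂ} (hw : 0 < w.re) : Complex.exp (logΓ₃ w) = Gamma₃ w := by
  have h := (logΓ₃_series.1 w hw).neg.hasSum.cexp
  have e : (Complex.exp ∘ fun n : ℕ => -(((n : ℂ) + 1) * (n + 2) / 2 * logRem 3 n w
        + (w - 1) ^ 3 / (6 * (n + 1) ^ 2)))
      = fun n : ℕ => ((1 + (w - 1) / (n + 1)) ^ ((n + 1) * (n + 2) / 2))⁻¹
        * Complex.exp ((w - 1) ^ 3 / (6 * (n + 1)) + (-1 / 4 - 1 / (4 * (n + 1))) * (w - 1) ^ 2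
            + (1 / 2 + ((n : ℂ) + 1) / 2) * (w - 1)) := by
    funext n
    have hne : (n : ℂ) + 1 ≠ 0 := Nat.cast_add_one_ne_zero n
    have hdiv : (((n + 1) * (n + 2) / 2 : ℕ) : ℂ) = ((n : ℂ) + 1) * (n + 2) / 2 := by
      have h2 : 2 ∣ (n + 1) * (n + 2) := (Nat.even_mul_succ_self (n + 1)).two_dvd
      rw [Nat.cast_div h2 (by norm_num)]
      push_cast
      ring
    rw [← Complex.exp_log (one_add_div_ne_zero n hw), ← Complex.exp_nat_mul, ← Complex.exp_neg,
      ← Complex.exp_add, hdiv]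
    simp only [Function.comp, logRem, Complex.logTaylor, Finset.sum_range_succ,
      Finset.sum_range_zero]
    congr 1
    generalize Complex.log (1 + (w - 1) / (n + 1)) = L
    push_cast
    field_simp
    ring
  rw [e] at h
  rw [Gamma₃, h.tprod_eq, ← Complex.exp_add, logΓ₃, tsum_neg]
  congr 1

theorem harm_eq (N : ℕ) : harm N = ((harmonic N : ℝ) : ℂ) := by
  simp [harm, harmonic]

theorem tendsto_harm_sub_log :
    Tendsto (fun N : ℕ => harm N - (Real.log N : ℝ)) atTop
      (𝓝 (Real.eulerMascheroniConstant : ℂ)) := by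
  refine ((Complex.continuous_ofReal.tendsto _).comp Real.tendsto_harmonic_sub_log).congr fun N => ?_
  simp [harm_eq]

theorem add_natCast_ne_zero (n : ℕ) {w : ℂ} (hw : 0 < w.re) : w + n ≠ 0 := by
  intro h
  have := congrArg Complex.re h
  simp at this
  linarith [(Nat.cast_nonneg n : (0 : ℝ) ≤ n)]

/-- The partial Weierstrass product is Euler's sequence `GammaSeq` times two factors tending to `1`:
one from `harm N - log N → γ`, and `w / N + 1`, because Euler's denominator has one factor more. -/
theorem exp_logΓ {w : ℂ} (hw : 0 < w.re) : Complex.exp (logΓ w) = Complex.Gamma w := by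
  have h1 := (Complex.continuous_exp.tendsto _).comp
    (tendstoLocallyUniformlyOn_logΓApprox.tendsto_at hw)
  have h2 : Tendsto (fun N : ℕ => Complex.GammaSeq w N
      * (Complex.exp ((harm N - (Real.log N : ℝ) - Real.eulerMascheroniConstant) * (w - 1))
        * (w / N + 1))) atTop (𝓝 (Complex.Gamma w)) := by
    have a1 : Tendsto (fun N : ℕ => Complex.exp ((harm N - (Real.log N : ℝ)
        - Real.eulerMascheroniConstant) * (w - 1))) atTop (𝓝 1) := by
      have := ((tendsto_harm_sub_log.sub_const
        (Real.eulerMascheroniConstant : ℂ)).mul_const (w - 1))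
      rw [sub_self, zero_mul] at this
      simpa [Function.comp_def] using (Complex.continuous_exp.tendsto _).comp this
    have a2 : Tendsto (fun N : ℕ => w / (N : ℂ) + 1) atTop (𝓝 1) := by
      simpa using (tendsto_const_div_atTop_nhds_zero_nat w).add_const 1
    simpa using (Complex.GammaSeq_tendsto_Gamma w).mul (a1.mul a2)
  refine tendsto_nhds_unique h1 (h2.congr' ?_)
  filter_upwards [eventually_ge_atTop 1] with N hN
  have hN0 : (N : ℂ) ≠ 0 := by exact_mod_cast (by omega : N ≠ 0)
  have hprod : Complex.exp (∑ n ∈ Finset.range N, (Complex.log (w + n) - (Real.log (n + 1) : ℝ)))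
      = (∏ n ∈ Finset.range N, (w + n)) / N.factorial := by
    rw [Complex.exp_sum]
    clear * - hw
    induction N with
    | zero => simp
    | succ N ih =>
      rw [Finset.prod_range_succ, Finset.prod_range_succ, ih, Complex.exp_sub,
        Complex.exp_log (add_natCast_ne_zero N hw), ← Complex.ofReal_exp,
        Real.exp_log (by positivity), Nat.factorial_succ]
      push_cast
      field_simp
  have hpne : ∏ n ∈ Finset.range N, (w + n) ≠ 0 :=
    Finset.prod_ne_zero_iff.2 fun n _ => add_natCast_ne_zero n hw
  have hwN := add_natCast_ne_zero N hw
  have hl : ((Real.log N : ℝ) : ℂ) = Complex.log N := by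
    rw [Complex.ofReal_log (by positivity)]; simp
  have hpow : (N : ℂ) ^ w = Complex.exp ((Real.log N : ℝ) * (w - 1)) * N := by
    have : (N : ℂ) ^ w = (N : ℂ) ^ (w - 1) * (N : ℂ) ^ (1 : ℂ) := by
      rw [← Complex.cpow_add _ _ hN0]; ring_nf
    rw [this, Complex.cpow_one, Complex.cpow_def_of_ne_zero hN0, hl]
  simp only [Function.comp, logΓApprox, Complex.GammaSeq, Finset.prod_range_succ]
  rw [Complex.exp_sub, hprod, hpow,
    show (harm N - Real.eulerMascheroniConstant) * (w - 1)
      = (Real.log N : ℝ) * (w - 1)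
        + (harm N - (Real.log N : ℝ) - Real.eulerMascheroniConstant) * (w - 1) by ring,
    Complex.exp_add]
  field_simp

/-! ### Asymptotic errors and the functional equations of `Γ₂` and `Γ₃` -/

/-- `∑_{k ≤ N} log k`. -/
noncomputable def sumLog (N : ℕ) : ℂ := ∑ n ∈ Finset.range N, ((Real.log (n + 1) : ℝ) : ℂ)

/-- `∑_{k ≤ N} k * log k`. -/
noncomputable def sumMulLog (N : ℕ) : ℂ :=
  ∑ n ∈ Finset.range N, ((n : ℂ) + 1) * ((Real.log (n + 1) : ℝ) : ℂ)

/-- The error in `∑_{k ≤ N} 1 / k ~ log N + γ`. -/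
noncomputable def harmErr (N : ℕ) : ℂ :=
  harm N - (Real.log N : ℝ) - Real.eulerMascheroniConstant

/-- The error in Stirling's formula. -/
noncomputable def sumLogErr (N : ℕ) : ℂ :=
  sumLog N - ((N : ℂ) + 1 / 2) * (Real.log N : ℝ) + N - (Real.log (2 * Real.pi) : ℝ) / 2

/-- The error in the asymptotic formula for the hyperfactorial. -/
noncomputable def sumMulLogErr (N : ℕ) : ℂ :=
  sumMulLog N - ((N : ℂ) ^ 2 / 2 + N / 2 + 1 / 12) * (Real.log N : ℝ) + (N : ℂ) ^ 2 / 4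
    - (Real.log glaisher : ℝ)

theorem tendsto_harmErr : Tendsto harmErr atTop (𝓝 0) := by
  have := tendsto_harm_sub_log.sub_const (Real.eulerMascheroniConstant : ℂ)
  rwa [sub_self] at this

theorem tendsto_sumLogErr : Tendsto sumLogErr atTop (𝓝 0) := by
  have h1 : Tendsto (fun N => Real.log (Stirling.stirlingSeq N)) atTop
      (𝓝 (Real.log √Real.pi)) :=
    ((Real.continuousAt_log (by positivity)).tendsto).comp Stirling.tendsto_stirlingSeq_sqrt_pi
  have h2 : Tendsto (fun N => ((Real.log (Stirling.stirlingSeq N) - Real.log √Real.pi : ℝ) : ℂ))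
      atTop (𝓝 0) := by
    have := (Complex.continuous_ofReal.tendsto _).comp (h1.sub_const (Real.log √Real.pi))
    simpa [Function.comp_def] using this
  refine h2.congr' ?_
  filter_upwards [eventually_ge_atTop 1] with N hN
  have hN0 : (N : ℝ) ≠ 0 := by exact_mod_cast (by omega : N ≠ 0)
  have hfac : (sumLog N : ℂ) = ((Real.log N.factorial : ℝ) : ℂ) := by
    clear * -
    induction N with
    | zero => simp [sumLog]
    | succ N ih =>
      rw [sumLog, Finset.sum_range_succ, ← sumLog, ih, Nat.factorial_succ, ← Complex.ofReal_add]
      congr 1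
      push_cast
      rw [Real.log_mul (by positivity) (by positivity)]
      ring
  rw [sumLogErr, hfac, Stirling.log_stirlingSeq_formula, Real.log_div hN0 (Real.exp_ne_zero _),
    Real.log_exp, Real.log_mul two_ne_zero hN0, Real.log_mul two_ne_zero Real.pi_ne_zero,
    Real.log_sqrt Real.pi_pos.le]
  push_cast
  ring

theorem sumMulLog_eq (N : ℕ) :
    sumMulLog N = ((∑ k ∈ Finset.Icc 1 N, (k : ℝ) * Real.log k : ℝ) : ℂ) := by
  induction N with
  | zero => simp [sumMulLog]
  | succ N ih =>
    rw [sumMulLog, Finset.sum_range_succ, ← sumMulLog, ih, Finset.sum_Icc_succ_top (by omega)]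
    push_cast
    ring

theorem tendsto_sumMulLogErr : Tendsto sumMulLogErr atTop (𝓝 0) := by
  have := (Complex.continuous_ofReal.tendsto _).comp
    (tendsto_glaisherSeq.sub_const (Real.log glaisher))
  rw [sub_self] at this
  refine this.congr fun N => ?_
  simp only [Function.comp, glaisherSeq, sumMulLogErr, sumMulLog_eq]
  push_cast
  ring

/-- The remainder of second order of `log (w + N)` as `N → ∞`. -/
noncomputable def logShiftErr (w : ℂ) (N : ℕ) : ℂ :=
  Complex.log (w + N) - (Real.log N : ℝ) - w / N + w ^ 2 / (2 * (N : ℂ) ^ 2)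

theorem norm_logShiftErr_le {w : ℂ} (hw : 0 < w.re) {N : ℕ} (hN : 1 ≤ N) :
    ‖logShiftErr w N‖ ≤ ‖w‖ ^ 3 / (N : ℝ) ^ 3 := by
  have hN0 : (N : ℂ) ≠ 0 := by exact_mod_cast (by omega : N ≠ 0)
  have hNpos : (0 : ℝ) < N := by exact_mod_cast (by omega : 0 < N)
  -- Since `Re w > 0`, the Taylor estimate applies with `δ = 1`.
  have hre : (1 : ℝ) ≤ 1 + (w / N).re := by
    have : (w / (N : ℂ)).re = w.re / N := by
      rw [show (N : ℂ) = ((N : ℝ) : ℂ) by simp, Complex.div_ofReal_re]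
    rw [this]
    have : 0 < w.re / N := by positivity
    linarith
  have h := norm_log_one_add_sub_logTaylor_le 2 one_pos le_rfl hre
  have e : 1 + w / N = (((N : ℝ)⁻¹ : ℝ) : ℂ) * (w + N) := by
    push_cast
    field_simp
    ring
  rw [e, Complex.log_ofReal_mul (by positivity) (add_natCast_ne_zero N hw), Real.log_inv] at h
  rw [norm_div, Complex.norm_natCast, div_one, div_pow] at h
  convert h using 2
  simp only [logShiftErr, Complex.logTaylor, Finset.sum_range_succ, Finset.sum_range_zero]
  push_cast
  field_simp
  ring

/-- The functional equation of `Γ₃` multiplies `log (w + N)` by `N (N + 1) / 2`, so the error must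
be `o(N⁻²)`; this is why the expansion goes to second order. -/
theorem tendsto_sq_mul_logShiftErr {w : ℂ} (hw : 0 < w.re) :
    Tendsto (fun N : ℕ => (N : ℂ) ^ 2 * logShiftErr w N) atTop (𝓝 0) := by
  refine squeeze_zero_norm' (a := fun N : ℕ => ‖w‖ ^ 3 / (N : ℝ)) ?_
    (tendsto_const_div_atTop_nhds_zero_nat _)
  filter_upwards [eventually_ge_atTop 1] with N hN
  have hNpos : (0 : ℝ) < N := by exact_mod_cast (by omega : 0 < N)
  rw [norm_mul, norm_pow, Complex.norm_natCast]
  calc _ ≤ (N : ℝ) ^ 2 * (‖w‖ ^ 3 / (N : ℝ) ^ 3) := by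
        gcongr
        exact norm_logShiftErr_le hw hN
    _ = _ := by field_simp

theorem tendsto_inv_natCast : Tendsto (fun N : ℕ => 1 / (N : ℂ)) atTop (𝓝 0) :=
  tendsto_const_div_atTop_nhds_zero_nat 1

theorem tendsto_mul_logShiftErr {w : ℂ} (hw : 0 < w.re) :
    Tendsto (fun N : ℕ => (N : ℂ) * logShiftErr w N) atTop (𝓝 0) := by
  have := tendsto_inv_natCast.mul (tendsto_sq_mul_logShiftErr hw)
  rw [zero_mul] at this
  refine this.congr' ?_
  filter_upwards [eventually_ge_atTop 1] with N hN
  have hN0 : (N : ℂ) ≠ 0 := by exact_mod_cast (by omega : N ≠ 0)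
  field_simp

theorem deriv_riemannZeta_zero_eq :
    deriv riemannZeta 0 = -((Real.log (2 * Real.pi) : ℝ) : ℂ) / 2 := by
  rw [deriv_riemannZeta_zero, Complex.ofReal_log (by positivity)]
  push_cast
  rfl

theorem re_add_one_pos {w : ℂ} (hw : 0 < w.re) : 0 < (w + 1).re := by
  simp only [Complex.add_re, Complex.one_re]
  linarith

/-- At level `N` the defect is a combination of the errors in the harmonic sum, in Stirling's
formula and in `log (w + N)`, plus a multiple of `1 / N`. The constant works out because `ζ'(0) =
-log (2π) / 2` matches Stirling's constant. -/
theorem logΓ₂_add_one {w : ℂ} (hw : 0 < w.re) : logΓ₂ (w + 1) = logΓ₂ w - logΓ w := by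
  have hw1 := re_add_one_pos hw
  have h1 := ((tendstoLocallyUniformlyOn_logΓ₂Approx.tendsto_at hw1).sub
    (tendstoLocallyUniformlyOn_logΓ₂Approx.tendsto_at hw)).add
    (tendstoLocallyUniformlyOn_logΓApprox.tendsto_at hw)
  have h2 : Tendsto (fun N : ℕ => -(1 / 2) * harmErr N + sumLogErr N + w ^ 2 / 2 * (1 / (N : ℂ))
      - N * logShiftErr w N) atTop (𝓝 0) := by
    have := (((tendsto_harmErr.const_mul (-(1 / 2))).add tendsto_sumLogErr).add
      (tendsto_inv_natCast.const_mul (w ^ 2 / 2))).sub (tendsto_mul_logShiftErr hw)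
    simp only [mul_zero, add_zero, sub_zero] at this
    exact this
  have h3 := tendsto_nhds_unique h1 (h2.congr' ?_)
  · linear_combination h3
  filter_upwards [eventually_ge_atTop 1] with N hN
  have hN0 : (N : ℂ) ≠ 0 := by exact_mod_cast (by omega : N ≠ 0)
  -- Summation by parts: the weights `n + 1` have first difference `1`, the weight for `Γ`.
  have tele : ∑ n ∈ Finset.range N, ((n : ℂ) + 1)
        * (Complex.log (w + 1 + n) - (Real.log (n + 1) : ℝ))
      - ∑ n ∈ Finset.range N, ((n : ℂ) + 1) * (Complex.log (w + n) - (Real.log (n + 1) : ℝ))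
      + ∑ n ∈ Finset.range N, (Complex.log (w + n) - (Real.log (n + 1) : ℝ))
      = N * Complex.log (w + N) - sumLog N := by
    clear * -
    induction N with
    | zero => simp [sumLog]
    | succ N ih =>
      have : w + 1 + (N : ℂ) = w + (N + 1) := by ring
      rw [sumLog] at *
      simp only [Finset.sum_range_succ, this]
      push_cast at ih ⊢
      linear_combination ih
  have hlog : Complex.log (w + N) = logShiftErr w N + (Real.log N : ℝ) + w / N
      - w ^ 2 / (2 * (N : ℂ) ^ 2) := by rw [logShiftErr]; ring
  have hlogN : (N : ℂ) * Complex.log (w + N) = N * logShiftErr w N + N * (Real.log N : ℝ) + w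
      - w ^ 2 / 2 * (1 / N) := by
    rw [hlog]
    field_simp
  rw [hlogN] at tele
  simp only [logΓ₂Approx, logΓApprox, harmErr, sumLogErr, deriv_riemannZeta_zero_eq]
  linear_combination tele

/-- As for `Γ₂`, one order higher: the hyperfactorial replaces the factorial, and `ζ'(-1) = 1/12 -
log A` makes the constants cancel. -/
theorem logΓ₃_add_one {w : ℂ} (hw : 0 < w.re) : logΓ₃ (w + 1) = logΓ₃ w - logΓ₂ w := by
  have hw1 := re_add_one_pos hw
  have h1 := ((tendstoLocallyUniformlyOn_logΓ₃Approx.tendsto_at hw1).sub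
    (tendstoLocallyUniformlyOn_logΓ₃Approx.tendsto_at hw)).add
    (tendstoLocallyUniformlyOn_logΓ₂Approx.tendsto_at hw)
  have h2 : Tendsto (fun N : ℕ => -(1 / 12) * harmErr N + sumMulLogErr N
      + w ^ 2 / 4 * (1 / (N : ℂ)) - 1 / 2 * (N ^ 2 * logShiftErr w N)
      - 1 / 2 * (N * logShiftErr w N)) atTop (𝓝 0) := by
    have := ((((tendsto_harmErr.const_mul (-(1 / 12))).add tendsto_sumMulLogErr).add
      (tendsto_inv_natCast.const_mul (w ^ 2 / 4))).sub
      ((tendsto_sq_mul_logShiftErr hw).const_mul (1 / 2))).sub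
      ((tendsto_mul_logShiftErr hw).const_mul (1 / 2))
    simp only [mul_zero, add_zero, sub_zero] at this
    exact this
  have h3 := tendsto_nhds_unique h1 (h2.congr' ?_)
  · linear_combination h3
  filter_upwards [eventually_ge_atTop 1] with N hN
  have hN0 : (N : ℂ) ≠ 0 := by exact_mod_cast (by omega : N ≠ 0)
  -- Triangular numbers have first differences `n + 1`, the weights for `Γ₂`.
  have tele : ∑ n ∈ Finset.range N, ((n : ℂ) + 1) * (n + 2) / 2
        * (Complex.log (w + 1 + n) - (Real.log (n + 1) : ℝ))
      - ∑ n ∈ Finset.range N, ((n : ℂ) + 1) * (n + 2) / 2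
        * (Complex.log (w + n) - (Real.log (n + 1) : ℝ))
      + ∑ n ∈ Finset.range N, ((n : ℂ) + 1) * (Complex.log (w + n) - (Real.log (n + 1) : ℝ))
      = N * (N + 1) / 2 * Complex.log (w + N) - sumMulLog N := by
    clear * -
    induction N with
    | zero => simp [sumMulLog]
    | succ N ih =>
      have : w + 1 + (N : ℂ) = w + (N + 1) := by ring
      rw [sumMulLog] at *
      simp only [Finset.sum_range_succ, this]
      push_cast at ih ⊢
      linear_combination ih
  have hlog : Complex.log (w + N) = logShiftErr w N + (Real.log N : ℝ) + w / N
      - w ^ 2 / (2 * (N : ℂ) ^ 2) := by rw [logShiftErr]; ring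
  have hlogN : (N : ℂ) * (N + 1) / 2 * Complex.log (w + N)
      = 1 / 2 * (N ^ 2 * logShiftErr w N) + 1 / 2 * (N * logShiftErr w N)
        + (N : ℂ) * (N + 1) / 2 * (Real.log N : ℝ) + (N + 1) * w / 2
      - w ^ 2 / 4 - w ^ 2 / 4 * (1 / N) := by
    rw [hlog]
    field_simp
    ring
  rw [hlogN] at tele
  simp only [logΓ₃Approx, logΓ₂Approx, harmErr, sumMulLogErr, deriv_riemannZeta_neg_one]
  linear_combination tele

/-! ### The multiplication formula -/

theorem sum_range_mul_eq {M : Type*} [AddCommMonoid M] (f : ℕ → M) (l N : ℕ) :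
    ∑ k ∈ Finset.range (l * N), f k
      = ∑ n ∈ Finset.range N, ∑ r ∈ Finset.range l, f (l * n + r) := by
  induction N with
  | zero => simp
  | succ N ih => rw [Nat.mul_succ, Finset.sum_range_add, ih, Finset.sum_range_succ]

theorem sum_range_quadratic (a b c : ℂ) (l : ℕ) :
    ∑ r ∈ Finset.range l, (a + b * r + c * (r : ℂ) ^ 2)
      = a * l + b * (l * (l - 1) / 2) + c * (l * (l - 1) * (2 * l - 1) / 6) := by
  induction l with
  | zero => simp
  | succ l ih => rw [Finset.sum_range_succ, ih]; push_cast; ring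

/-- The exponent in front of the product defining `F`. -/
noncomputable def expoF (l : ℕ) (s : ℂ) : ℂ :=
  -(s / l) * (Real.log (k₂ l ^ (-2 : ℤ) * k₁ l) : ℝ)
      + s * (s + l) / 2 * (Real.log (2 * Real.pi) : ℝ)
      + s * (s + l) * (3 - 2 * s - l) / (6 * l) * (Real.log l : ℝ)

theorem log_k₂_k₁ {l : ℕ} (hl : 1 ≤ l) :
    Real.log (k₂ l ^ (-2 : ℤ) * k₁ l)
      = -2 * ((1 - (l : ℝ) ^ 2) * Real.log glaisher + ((l : ℝ) ^ 2 - 1) / 12)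
        + ((l : ℝ) - 1) / 2 * Real.log (2 * Real.pi) + 1 / 3 * Real.log l := by
  have hlpos : (0 : ℝ) < l := by exact_mod_cast hl
  have hA := glaisher_pos
  have hk2 : 0 < k₂ l := by unfold k₂; positivity
  have hk1 : 0 < k₁ l := by unfold k₁; positivity
  rw [Real.log_mul (by positivity) (by positivity), Real.log_zpow, k₂, k₁,
    Real.log_mul (by positivity) (by positivity), Real.log_mul (by positivity) (by positivity),
    Real.log_mul (by positivity) (by positivity), Real.log_mul (by positivity) (by positivity),
    Real.log_exp, Real.log_rpow hA, Real.log_rpow (by positivity), Real.log_rpow (by positivity),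
    Real.log_rpow (by positivity)]
  push_cast
  ring

theorem re_add_natCast_div_pos {l : ℕ} (hl : 1 ≤ l) {y : ℂ} (hy : 0 < y.re) (r : ℕ) :
    0 < ((y + r) / l).re := by
  have hlpos : (0 : ℝ) < l := by exact_mod_cast hl
  rw [show (l : ℂ) = ((l : ℝ) : ℂ) by simp, Complex.div_ofReal_re]
  simp only [Complex.add_re, Complex.natCast_re]
  positivity

/-- The multiplication formula of `Γ₂ ^ 2 / Γ`, in logarithmic form. -/
theorem sum_logΓ₂_sub_logΓ {l : ℕ} (hl : 1 ≤ l) {y : ℂ} (hy : 0 < y.re) :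
    ∑ r ∈ Finset.range l, (2 * (l : ℂ) * logΓ₂ ((y + r) / l)
        - (2 * l - 1 - 2 * r) * logΓ ((y + r) / l)) + expoF l y - expoF l (y - l)
      = y * (Real.log (2 * Real.pi) : ℝ) + 2 * logΓ₂ y - logΓ y := by
  have hl0 : (l : ℂ) ≠ 0 := by exact_mod_cast (by omega : l ≠ 0)
  have hlpos : (0 : ℝ) < l := by exact_mod_cast hl
  have hlN : Tendsto (fun N : ℕ => l * N) atTop atTop :=
    tendsto_id.const_mul_atTop' (by omega)
  have hw := fun r => re_add_natCast_div_pos hl hy r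
  have h1 : Tendsto (fun N => ∑ r ∈ Finset.range l, (2 * (l : ℂ) * logΓ₂Approx N ((y + r) / l)
        - (2 * l - 1 - 2 * r) * logΓApprox N ((y + r) / l))
        - (2 * logΓ₂Approx (l * N) y - logΓApprox (l * N) y)) atTop
      (𝓝 (∑ r ∈ Finset.range l, (2 * (l : ℂ) * logΓ₂ ((y + r) / l)
        - (2 * l - 1 - 2 * r) * logΓ ((y + r) / l)) - (2 * logΓ₂ y - logΓ y))) := by
    refine Tendsto.sub (tendsto_finsetSum _ fun r _ => ?_) ?_
    · exact ((tendstoLocallyUniformlyOn_logΓ₂Approx.tendsto_at (hw r)).const_mul _).sub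
        ((tendstoLocallyUniformlyOn_logΓApprox.tendsto_at (hw r)).const_mul _)
    · exact (((tendstoLocallyUniformlyOn_logΓ₂Approx.tendsto_at hy).comp hlN).const_mul _).sub
        ((tendstoLocallyUniformlyOn_logΓApprox.tendsto_at hy).comp hlN)
  have hH := tendsto_harmErr
  have hH' := tendsto_harmErr.comp hlN
  have hL := tendsto_sumLogErr
  have hL' := tendsto_sumLogErr.comp hlN
  have hG := tendsto_sumMulLogErr
  have hG' := tendsto_sumMulLogErr.comp hlN
  -- With this notation `(y + r) / l - 1 = (u + r) / l`, so sums over `r` of the polynomial parts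
  -- reduce to `sum_range_quadratic`.
  set u := y - l with hu
  -- coefficients of `harmErr N`
  set cH : ℂ := -(u ^ 2 / l * l + 2 * u / l * (l * (l - 1) / 2)
      + 1 / l * (l * (l - 1) * (2 * l - 1) / 6))
    + ((1 - 2 * l) * u / l * l + (2 * u / l + (1 - 2 * l) / l) * (l * (l - 1) / 2)
      + 2 / l * (l * (l - 1) * (2 * l - 1) / 6)) with hcH
  have h2 : Tendsto (fun N : ℕ => cH * harmErr N + ((y - 1) ^ 2 + (y - 1)) * harmErr (l * N)
      + 2 * (l : ℂ) ^ 2 * sumMulLogErr N - 2 * sumMulLogErr (l * N)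
      - (l : ℂ) ^ 2 * sumLogErr N + sumLogErr (l * N)
      + (y * (Real.log (2 * Real.pi) : ℝ) - expoF l y + expoF l u)) atTop
      (𝓝 (y * (Real.log (2 * Real.pi) : ℝ) - expoF l y + expoF l u)) := by
    simpa using ((((((hH.const_mul cH).add (hH'.const_mul ((y - 1) ^ 2 + (y - 1)))).add
      (hG.const_mul (2 * (l : ℂ) ^ 2))).sub (hG'.const_mul 2)).sub
      (hL.const_mul ((l : ℂ) ^ 2))).add hL').add_const
      (y * (Real.log (2 * Real.pi) : ℝ) - expoF l y + expoF l u)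
  have h3 := tendsto_nhds_unique h1 (h2.congr' ?_)
  · linear_combination h3
  filter_upwards [eventually_ge_atTop 1] with N hN
  have hNpos : (0 : ℝ) < N := by exact_mod_cast hN
  have hlogw : ∀ r n : ℕ, Complex.log ((y + r) / l + n)
      = Complex.log (y + (l * n + r : ℕ)) - (Real.log l : ℝ) := by
    intro r n
    have : (y + r) / l + n = (((l : ℝ)⁻¹ : ℝ) : ℂ) * (y + (l * n + r : ℕ)) := by
      push_cast
      field_simp
      ring
    rw [this, Complex.log_ofReal_mul (by positivity) (add_natCast_ne_zero _ hy), Real.log_inv]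
    push_cast
    ring
  have hsq : ∑ k ∈ Finset.range (l * N), (2 * (k : ℂ) + 1) = ((l : ℂ) * N) ^ 2 := by
    have : ∀ M : ℕ, ∑ k ∈ Finset.range M, (2 * (k : ℂ) + 1) = (M : ℂ) ^ 2 := by
      intro M
      induction M with
      | zero => simp
      | succ M ih => rw [Finset.sum_range_succ, ih]; push_cast; ring
    rw [this]
    push_cast
    ring
  -- With `k = l n + r` the weights combine as `2 l (n + 1) - (2 l - 1 - 2 r) = 2 k + 1`, which is
  -- also the weight `2 (k + 1) - 1` of `log (y + k)` in `2 logΓ₂ y - logΓ y`. Hence `N` terms for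
  -- each residue `r` match `l N` terms on the other side.
  have hlogs : ∑ r ∈ Finset.range l, (2 * (l : ℂ) * ∑ n ∈ Finset.range N, ((n : ℂ) + 1)
          * (Complex.log ((y + r) / l + n) - (Real.log (n + 1) : ℝ))
        - (2 * l - 1 - 2 * r) * ∑ n ∈ Finset.range N,
          (Complex.log ((y + r) / l + n) - (Real.log (n + 1) : ℝ)))
      = 2 * ∑ k ∈ Finset.range (l * N), ((k : ℂ) + 1)
          * (Complex.log (y + k) - (Real.log (k + 1) : ℝ))
        - ∑ k ∈ Finset.range (l * N), (Complex.log (y + k) - (Real.log (k + 1) : ℝ))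
        - ((l : ℂ) * N) ^ 2 * (Real.log l : ℝ) + 2 * sumMulLog (l * N) - sumLog (l * N)
        - 2 * (l : ℂ) ^ 2 * sumMulLog N + (l : ℂ) ^ 2 * sumLog N := by
    have e1 : 2 * ∑ k ∈ Finset.range (l * N), ((k : ℂ) + 1)
          * (Complex.log (y + k) - (Real.log (k + 1) : ℝ))
        - ∑ k ∈ Finset.range (l * N), (Complex.log (y + k) - (Real.log (k + 1) : ℝ))
        - ((l : ℂ) * N) ^ 2 * (Real.log l : ℝ) + 2 * sumMulLog (l * N) - sumLog (l * N)
        = ∑ k ∈ Finset.range (l * N), (2 * (k : ℂ) + 1) * (Complex.log (y + k) - (Real.log l : ℝ)) := by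
      rw [← hsq, sumMulLog, sumLog, Finset.sum_mul, Finset.mul_sum, Finset.mul_sum,
        ← Finset.sum_sub_distrib, ← Finset.sum_sub_distrib, ← Finset.sum_add_distrib,
        ← Finset.sum_sub_distrib]
      refine Finset.sum_congr rfl fun k _ => ?_
      ring
    have e2 : - 2 * (l : ℂ) ^ 2 * sumMulLog N + (l : ℂ) ^ 2 * sumLog N
        = -∑ n ∈ Finset.range N, ∑ r ∈ Finset.range l,
          (2 * ((l * n + r : ℕ) : ℂ) + 1) * (Real.log (n + 1) : ℝ) := by
      rw [sumMulLog, sumLog, Finset.mul_sum, Finset.mul_sum, ← Finset.sum_add_distrib,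
        ← Finset.sum_neg_distrib]
      refine Finset.sum_congr rfl fun n _ => ?_
      rw [← Finset.sum_mul]
      have : ∑ r ∈ Finset.range l, (2 * ((l * n + r : ℕ) : ℂ) + 1)
          = ∑ r ∈ Finset.range l, ((2 * l * n + 1) + 2 * (r : ℂ) + 0 * (r : ℂ) ^ 2) :=
        Finset.sum_congr rfl fun r _ => by push_cast; ring
      rw [this, sum_range_quadratic]
      ring
    have e3 : ∑ r ∈ Finset.range l, (2 * (l : ℂ) * ∑ n ∈ Finset.range N, ((n : ℂ) + 1)
          * (Complex.log ((y + r) / l + n) - (Real.log (n + 1) : ℝ))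
        - (2 * l - 1 - 2 * r) * ∑ n ∈ Finset.range N,
          (Complex.log ((y + r) / l + n) - (Real.log (n + 1) : ℝ)))
        = ∑ n ∈ Finset.range N, ∑ r ∈ Finset.range l, (2 * ((l * n + r : ℕ) : ℂ) + 1)
          * (Complex.log (y + (l * n + r : ℕ)) - (Real.log l : ℝ) - (Real.log (n + 1) : ℝ)) := by
      rw [Finset.sum_comm]
      refine Finset.sum_congr rfl fun r _ => ?_
      rw [Finset.mul_sum, Finset.mul_sum, ← Finset.sum_sub_distrib]
      refine Finset.sum_congr rfl fun n _ => ?_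
      rw [hlogw]
      push_cast
      ring
    have e4 : ∑ n ∈ Finset.range N, ∑ r ∈ Finset.range l, (2 * ((l * n + r : ℕ) : ℂ) + 1)
          * (Complex.log (y + (l * n + r : ℕ)) - (Real.log l : ℝ) - (Real.log (n + 1) : ℝ))
        = ∑ n ∈ Finset.range N, ∑ r ∈ Finset.range l, (2 * ((l * n + r : ℕ) : ℂ) + 1)
          * (Complex.log (y + (l * n + r : ℕ)) - (Real.log l : ℝ))
          - ∑ n ∈ Finset.range N, ∑ r ∈ Finset.range l,
          (2 * ((l * n + r : ℕ) : ℂ) + 1) * (Real.log (n + 1) : ℝ) := by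
      simp only [← Finset.sum_sub_distrib]
      exact Finset.sum_congr rfl fun n _ => Finset.sum_congr rfl fun r _ => by ring
    rw [e3, e4]
    rw [sum_range_mul_eq (fun k : ℕ => (2 * (k : ℂ) + 1)
      * (Complex.log (y + k) - (Real.log l : ℝ)))] at e1
    linear_combination -e1 - e2
  have hpoly : ∀ P Q T : ℂ, ∑ r ∈ Finset.range l, (2 * (l : ℂ) * (P * ((y + r) / l - 1) ^ 2
        + Q * ((y + r) / l - 1)) - (2 * l - 1 - 2 * r) * (T * ((y + r) / l - 1)))
      = (2 * P * u ^ 2 / l + 2 * Q * u + (1 - 2 * l) * T * u / l) * l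
        + (4 * P * u / l + 2 * Q + 2 * T * u / l + (1 - 2 * l) * T / l) * (l * (l - 1) / 2)
        + (2 * P / l + 2 * T / l) * (l * (l - 1) * (2 * l - 1) / 6) := by
    intro P Q T
    rw [← sum_range_quadratic]
    refine Finset.sum_congr rfl fun r _ => ?_
    rw [hu]
    field_simp
    ring
  have hsplit : ∑ r ∈ Finset.range l, (2 * (l : ℂ) * logΓ₂Approx N ((y + r) / l)
        - (2 * l - 1 - 2 * r) * logΓApprox N ((y + r) / l))
      = ∑ r ∈ Finset.range l, (2 * (l : ℂ)
          * ((1 / 2 + Real.eulerMascheroniConstant / 2 - harm N / 2) * ((y + r) / l - 1) ^ 2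
            + (1 / 2 + deriv riemannZeta 0 + N) * ((y + r) / l - 1))
          - (2 * l - 1 - 2 * r)
            * ((harm N - Real.eulerMascheroniConstant) * ((y + r) / l - 1)))
        - ∑ r ∈ Finset.range l, (2 * (l : ℂ) * ∑ n ∈ Finset.range N, ((n : ℂ) + 1)
          * (Complex.log ((y + r) / l + n) - (Real.log (n + 1) : ℝ))
        - (2 * l - 1 - 2 * r) * ∑ n ∈ Finset.range N,
          (Complex.log ((y + r) / l + n) - (Real.log (n + 1) : ℝ))) := by
    rw [← Finset.sum_sub_distrib]
    refine Finset.sum_congr rfl fun r _ => ?_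
    rw [logΓ₂Approx, logΓApprox]
    ring
  -- All `log (y + k)` now cancel. What remains is an algebraic identity in the errors, `log A`,
  -- `log (2π)` and `log l`, in which the constants `k₁`, `k₂` and the exponent of `F` are accounted
  -- for.
  rw [hsplit, hpoly, hlogs, logΓ₂Approx, logΓApprox, expoF, expoF, log_k₂_k₁ hl]
  have hlogmul : Real.log ((l * N : ℕ) : ℝ) = Real.log l + Real.log N := by
    push_cast
    rw [Real.log_mul (by positivity) (by positivity)]
  simp only [harmErr, sumLogErr, sumMulLogErr, hlogmul, deriv_riemannZeta_zero_eq, hcH, hu]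
  push_cast
  field_simp
  ring

/-! ### Identification of the branches -/

theorem logBranch_eq {f Φ : ℂ → ℂ} {U : Set ℂ} (hU : IsOpen U) (hconv : Convex ℝ U)
    (h1 : (1 : ℂ) ∈ U) (hΦ : DifferentiableOn ℂ Φ U) (hf : ∀ w ∈ U, Complex.exp (Φ w) = f w)
    (him : (Φ 1).im = 0) {s : ℂ} (hs : s ∈ U) : logBranch f s = Φ s := by
  have hseg : ∀ t ∈ Set.Icc (0 : ℝ) 1, (1 : ℂ) + t • (s - 1) ∈ U := by
    intro t ht
    have := hconv.add_smul_sub_mem h1 hs ht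
    simpa using this
  have hlog : ∀ w ∈ U, logDeriv f w = deriv Φ w := by
    intro w hw
    have hev : f =ᶠ[𝓝 w] fun u => Complex.exp (Φ u) := by
      filter_upwards [hU.mem_nhds hw] with u hu using (hf u hu).symm
    rw [logDeriv_apply, hev.deriv_eq, ← hf w hw,
      ((hΦ.differentiableAt (hU.mem_nhds hw)).hasDerivAt.cexp).deriv]
    field_simp
  -- Along the segment `f' / f = Φ'`, so the integral in `logBranch` is an increment of `Φ`.
  have hint := intervalIntegral.integral_unitInterval_deriv_eq_sub (f := Φ) (f' := deriv Φ)
    (z₀ := 1) (z₁ := s - 1)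
    (((hΦ.deriv hU).continuousOn).comp (by fun_prop) fun t ht => hseg t ht)
    (fun t ht => (hΦ.differentiableAt (hU.mem_nhds (hseg t ht))).hasDerivAt)
  have hcongr : ∫ t in (0 : ℝ)..1, (s - 1) * logDeriv f (1 + t * (s - 1))
      = (s - 1) * ∫ t in (0 : ℝ)..1, deriv Φ (1 + t • (s - 1)) := by
    rw [← intervalIntegral.integral_const_mul]
    refine intervalIntegral.integral_congr fun t ht => ?_
    rw [Set.uIcc_of_le zero_le_one] at ht
    rw [← hlog _ (hseg t ht), Complex.real_smul]
  -- The starting values agree because `Φ 1` is real, hence inside the strip where `log ∘ exp` is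
  -- the identity.
  have hlog1 : Complex.log (f 1) = Φ 1 := by
    rw [← hf 1 h1, Complex.log_exp] <;> rw [him]
    · exact neg_lt_zero.2 Real.pi_pos
    · exact Real.pi_pos.le
  rw [logBranch, hcongr]
  simp only [smul_eq_mul] at hint
  rw [hint, hlog1]
  simp

theorem logΓ_one : logΓ 1 = 0 := by
  simp [logΓ, logRem, Complex.logTaylor_at_zero]

theorem logΓ₂_one : logΓ₂ 1 = 0 := by
  simp [logΓ₂, logRem, Complex.logTaylor_at_zero]

theorem im_eq_zero_of_tendsto {f : ℕ → ℂ} {z : ℂ} (h : Tendsto f atTop (𝓝 z))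
    (hf : ∀ n, (starRingEnd ℂ) (f n) = f n) : z.im = 0 := by
  refine tendsto_nhds_unique ((Complex.continuous_im.tendsto z).comp h) ?_
  refine tendsto_const_nhds.congr fun n => ?_
  exact (Complex.conj_eq_iff_im.1 (hf n)).symm

theorem log_ofReal_add_natCast {x : ℝ} (hx : 0 < x) (n : ℕ) :
    Complex.log ((x : ℂ) + n) = ((Real.log (x + n) : ℝ) : ℂ) := by
  rw [Complex.ofReal_log (by positivity)]
  push_cast
  rfl

theorem im_logΓ₂_ofReal {x : ℝ} (hx : 0 < x) : (logΓ₂ x).im = 0 := by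
  refine im_eq_zero_of_tendsto (tendstoLocallyUniformlyOn_logΓ₂Approx.tendsto_at
    (a := (x : ℂ)) (by simpa using hx)) fun N => ?_
  simp only [logΓ₂Approx, log_ofReal_add_natCast hx, deriv_riemannZeta_zero_eq, harm_eq, map_sub,
    map_add, map_mul, map_sum, map_pow, map_div₀, map_neg, Complex.conj_ofReal, map_natCast,
    map_one, map_ofNat]

theorem im_logΓ₃_ofReal {x : ℝ} (hx : 0 < x) : (logΓ₃ x).im = 0 := by
  refine im_eq_zero_of_tendsto (tendstoLocallyUniformlyOn_logΓ₃Approx.tendsto_at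
    (a := (x : ℂ)) (by simpa using hx)) fun N => ?_
  simp only [logΓ₃Approx, log_ofReal_add_natCast hx, deriv_riemannZeta_zero_eq,
    deriv_riemannZeta_neg_one, harm_eq, map_sub, map_add, map_mul, map_sum, map_pow, map_div₀,
    map_neg, Complex.conj_ofReal, map_natCast, map_one, map_ofNat]

/-! ### Derivatives of the approximations and their mean defects -/

theorem differentiable_logΓApprox (N : ℕ) :
    DifferentiableOn ℂ (logΓApprox N) {w : ℂ | 0 < w.re} := by
  unfold logΓApprox
  refine DifferentiableOn.sub (by fun_prop) (DifferentiableOn.fun_sum fun n _ => ?_)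
  refine DifferentiableOn.sub_const (fun w hw => ?_) _
  exact ((differentiableAt_id.add_const _).clog
    (Or.inl (by simpa using (add_pos_of_pos_of_nonneg hw (Nat.cast_nonneg n))))).differentiableWithinAt

/-- A cubic polynomial minus a finite combination of the functions `log (w + n)`: the shape of
the approximations of `log Γ₂` and `log Γ₃`. -/
noncomputable def cubicSubLogs (a b c : ℂ) (q κ : ℕ → ℂ) (N : ℕ) (w : ℂ) : ℂ :=
  a * (w - 1) ^ 3 + b * (w - 1) ^ 2 + c * (w - 1)
    - ∑ n ∈ Finset.range N, q n * (Complex.log (w + n) - κ n)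

theorem hasDerivAt_cubicSubLogs (a b c : ℂ) (q κ : ℕ → ℂ) (N : ℕ) {w : ℂ} (hw : 0 < w.re) :
    HasDerivAt (cubicSubLogs a b c q κ N)
      (3 * a * (w - 1) ^ 2 + 2 * b * (w - 1) + c - ∑ n ∈ Finset.range N, q n * (1 / (w + n))) w := by
  have hz : HasDerivAt (fun w : ℂ => w - 1) 1 w := (hasDerivAt_id w).sub_const 1
  have hs : HasDerivAt (fun w : ℂ => ∑ n ∈ Finset.range N, q n * (Complex.log (w + n) - κ n))
      (∑ n ∈ Finset.range N, q n * (1 / (w + n))) w :=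
    HasDerivAt.fun_sum fun n _ => ((((hasDerivAt_id w).add_const (n : ℂ)).clog
      (Or.inl (by simpa using (add_pos_of_pos_of_nonneg hw (Nat.cast_nonneg n))))).sub_const
        (κ n)).const_mul (q n)
  have := ((((hz.pow 3).const_mul a).add ((hz.pow 2).const_mul b)).add (hz.const_mul c)).sub hs
  refine this.congr_deriv ?_
  push_cast
  ring

theorem hasDerivAt_deriv_cubicSubLogs (a b c : ℂ) (q κ : ℕ → ℂ) (N : ℕ) {w : ℂ}
    (hw : 0 < w.re) :
    HasDerivAt (deriv (cubicSubLogs a b c q κ N))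
      (6 * a * (w - 1) + 2 * b + ∑ n ∈ Finset.range N, q n * (1 / (w + n) ^ 2)) w := by
  have hz : HasDerivAt (fun w : ℂ => w - 1) 1 w := (hasDerivAt_id w).sub_const 1
  have hs : HasDerivAt (fun w : ℂ => ∑ n ∈ Finset.range N, q n * (1 / (w + n)))
      (∑ n ∈ Finset.range N, q n * (-1 / (w + n) ^ 2)) w := by
    refine HasDerivAt.fun_sum fun n _ => ?_
    have := ((hasDerivAt_id w).add_const (n : ℂ)).inv (add_natCast_ne_zero n hw)
    simpa using this.const_mul (q n)
  have h := ((((hz.pow 2).const_mul (3 * a)).add (hz.const_mul (2 * b))).add_const c).sub hs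
  have hev : deriv (cubicSubLogs a b c q κ N) =ᶠ[𝓝 w] fun w =>
      3 * a * (w - 1) ^ 2 + 2 * b * (w - 1) + c - ∑ n ∈ Finset.range N, q n * (1 / (w + n)) := by
    filter_upwards [re_pos_isOpen.mem_nhds hw] with u hu
    exact (hasDerivAt_cubicSubLogs a b c q κ N hu).deriv
  refine (HasDerivAt.congr_of_eventuallyEq (f' := _) ?_ hev)
  refine h.congr_deriv ?_
  rw [show (∑ n ∈ Finset.range N, q n * (-1 / (w + n) ^ 2))
    = -∑ n ∈ Finset.range N, q n * (1 / (w + n) ^ 2) by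
      rw [← Finset.sum_neg_distrib]; exact Finset.sum_congr rfl fun n _ => by ring]
  push_cast
  ring

/-- The second derivative of `f` minus its mean over the interval of length `1` around `w`. -/
noncomputable def meanDefect (f : ℂ → ℂ) (w : ℂ) : ℂ :=
  deriv (deriv f) w - (deriv f (w + 1 / 2) - deriv f (w - 1 / 2))

/-- The second derivative of a cubic is affine, so its mean over a symmetric interval is its value
at the centre. The coefficients `a`, `b`, `c` drop out, although they need not converge, and only
the logarithms contribute. Local uniformity allows two differentiations. -/
theorem tendsto_meanDefect {Φ : ℂ → ℂ} {a b c : ℕ → ℂ} {q κ : ℕ → ℂ}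
    (h : TendstoLocallyUniformlyOn (fun N => cubicSubLogs (a N) (b N) (c N) q κ N) Φ atTop
      {w : ℂ | 0 < w.re}) {w : ℂ} (hw : 1 / 2 < w.re) :
    Tendsto (fun N => ∑ n ∈ Finset.range N, q n * (1 / (w + n) ^ 2 - 1 / (w - 1 / 2 + n)
      + 1 / (w + 1 / 2 + n))) atTop (𝓝 (meanDefect Φ w)) := by
  have hw0 : 0 < w.re := by linarith
  have hwp : 0 < (w + 1 / 2).re := by simp; linarith
  have hwm : 0 < (w - 1 / 2).re := by simp; linarith
  have hd1 : ∀ N, DifferentiableOn ℂ (cubicSubLogs (a N) (b N) (c N) q κ N) {w : ℂ | 0 < w.re} :=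
    fun N u hu => (hasDerivAt_cubicSubLogs _ _ _ _ _ N hu).differentiableAt.differentiableWithinAt
  have hd2 : ∀ N, DifferentiableOn ℂ (deriv (cubicSubLogs (a N) (b N) (c N) q κ N))
      {w : ℂ | 0 < w.re} := fun N u hu =>
    (hasDerivAt_deriv_cubicSubLogs _ _ _ _ _ N hu).differentiableAt.differentiableWithinAt
  have h1 := h.deriv (Eventually.of_forall hd1) re_pos_isOpen
  have h2 := h1.deriv (Eventually.of_forall hd2) re_pos_isOpen
  have key := (h2.tendsto_at hw0).sub ((h1.tendsto_at hwp).sub (h1.tendsto_at hwm))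
  refine key.congr fun N => ?_
  simp only [Function.comp]
  rw [(hasDerivAt_cubicSubLogs _ _ _ _ _ N hwp).deriv, (hasDerivAt_cubicSubLogs _ _ _ _ _ N hwm).deriv,
    (hasDerivAt_deriv_cubicSubLogs _ _ _ _ _ N hw0).deriv]
  simp only [mul_add, mul_sub, Finset.sum_add_distrib, Finset.sum_sub_distrib]
  ring

theorem tendsto_meanDefect_logΓ₂ {w : ℂ} (hw : 1 / 2 < w.re) :
    Tendsto (fun N => ∑ n ∈ Finset.range N, ((n : ℂ) + 1) * (1 / (w + n) ^ 2
      - 1 / (w - 1 / 2 + n) + 1 / (w + 1 / 2 + n))) atTop (𝓝 (meanDefect logΓ₂ w)) := by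
  refine tendsto_meanDefect (a := fun _ => 0)
    (b := fun N => 1 / 2 + Real.eulerMascheroniConstant / 2 - harm N / 2)
    (c := fun N => 1 / 2 + deriv riemannZeta 0 + N)
    (q := fun n => (n : ℂ) + 1) (κ := fun n => (Real.log (n + 1) : ℝ)) ?_ hw
  refine tendstoLocallyUniformlyOn_logΓ₂Approx.congr fun N _ _ => ?_
  simp only [logΓ₂Approx, cubicSubLogs]
  ring

theorem tendsto_meanDefect_logΓ₃ {w : ℂ} (hw : 1 / 2 < w.re) :
    Tendsto (fun N => ∑ n ∈ Finset.range N, ((n : ℂ) + 1) * (n + 2) / 2 * (1 / (w + n) ^ 2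
      - 1 / (w - 1 / 2 + n) + 1 / (w + 1 / 2 + n))) atTop (𝓝 (meanDefect logΓ₃ w)) := by
  exact tendsto_meanDefect (q := fun n => ((n : ℂ) + 1) * (n + 2) / 2)
    tendstoLocallyUniformlyOn_logΓ₃Approx hw

theorem differentiableOn_logΓ : DifferentiableOn ℂ logΓ {w : ℂ | 0 < w.re} :=
  tendstoLocallyUniformlyOn_logΓApprox.differentiableOn
    (Eventually.of_forall differentiable_logΓApprox) re_pos_isOpen

theorem differentiableOn_logΓ₃ : DifferentiableOn ℂ logΓ₃ {w : ℂ | 0 < w.re} :=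
  tendstoLocallyUniformlyOn_logΓ₃Approx.differentiableOn
    (Eventually.of_forall fun N _ hu => (hasDerivAt_cubicSubLogs _ _ _
      (fun n => ((n : ℂ) + 1) * (n + 2) / 2) _ N hu).differentiableAt.differentiableWithinAt)
    re_pos_isOpen

theorem differentiableOn_logΓ₂ : DifferentiableOn ℂ logΓ₂ {w : ℂ | 0 < w.re} := by
  refine tendstoLocallyUniformlyOn_logΓ₂Approx.differentiableOn
    (Eventually.of_forall fun N => ?_) re_pos_isOpen
  have : DifferentiableOn ℂ (cubicSubLogs 0
      (1 / 2 + Real.eulerMascheroniConstant / 2 - harm N / 2)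
      (1 / 2 + deriv riemannZeta 0 + N) (fun n => (n : ℂ) + 1)
      (fun n => (Real.log (n + 1) : ℝ)) N) {w : ℂ | 0 < w.re} :=
    fun u hu => (hasDerivAt_cubicSubLogs _ _ _ _ _ N hu).differentiableAt.differentiableWithinAt
  refine this.congr fun u _ => ?_
  simp only [logΓ₂Approx, cubicSubLogs]
  ring

/-! ### The functions `logF` and `logG` and the ladder relation -/

/-- The logarithm of `F l` on `Re s > -l`. -/
noncomputable def logF (l : ℕ) (s : ℂ) : ℂ :=
  expoF l s + ∑ r ∈ Finset.range l, (-(2 * (l : ℂ)) * logΓ₃ ((s + l + r) / l)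
    + (2 * l - 1 - 2 * r) * logΓ₂ ((s + l + r) / l))

/-- The logarithm of `(2 π) ^ s * Γ₂ s ^ 2 / Γ s` on the right half plane. -/
noncomputable def logG (s : ℂ) : ℂ :=
  s * (Real.log (2 * Real.pi) : ℝ) + (2 * logΓ₂ s - logΓ s)

theorem isOpen_re_gt (a : ℝ) : IsOpen {s : ℂ | a < s.re} :=
  isOpen_lt continuous_const Complex.continuous_re

theorem re_add_pos {l : ℕ} {s : ℂ} (hs : -(l : ℝ) < s.re) : 0 < (s + l).re := by
  simp only [Complex.add_re, Complex.natCast_re]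
  linarith

theorem exp_logF {l : ℕ} (hl : 1 ≤ l) {s : ℂ} (hs : -(l : ℝ) < s.re) :
    Complex.exp (logF l s) = F l s := by
  rw [logF, Complex.exp_add, Complex.exp_sum, F, expoF]
  congr 1
  refine Finset.prod_congr rfl fun r _ => ?_
  have hw := re_add_natCast_div_pos hl (re_add_pos hs) r
  rw [Complex.exp_add, ← exp_logΓ₃ hw, ← exp_logΓ₂ hw, ← Complex.exp_int_mul,
    ← Complex.exp_int_mul]
  congr 2 <;> push_cast <;> ring

theorem exp_two_mul_logΓ₂_sub {s : ℂ} (hs : 0 < s.re) :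
    Complex.exp (2 * logΓ₂ s - logΓ s) = Gamma₂ s ^ 2 / Complex.Gamma s := by
  rw [Complex.exp_sub, exp_logΓ hs, ← exp_logΓ₂ hs, ← Complex.exp_nat_mul]
  norm_num

/-- The shift by `l` adds one to each argument. The functional equations then leave exactly the sum
evaluated by the multiplication formula at `y = s + l`. -/
theorem logF_add {l : ℕ} (hl : 1 ≤ l) {s : ℂ} (hs : -(l : ℝ) < s.re) :
    logF l (s + l) = logF l s + logG (s + l) := by
  have hy := re_add_pos hs
  have hl0 : (l : ℂ) ≠ 0 := by exact_mod_cast (by omega : l ≠ 0)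
  have h := sum_logΓ₂_sub_logΓ hl hy
  rw [add_sub_cancel_right] at h
  have hsum : ∑ r ∈ Finset.range l, (-(2 * (l : ℂ)) * logΓ₃ ((s + l + l + r) / l)
      + (2 * l - 1 - 2 * r) * logΓ₂ ((s + l + l + r) / l))
      = ∑ r ∈ Finset.range l, (-(2 * (l : ℂ)) * logΓ₃ ((s + l + r) / l)
        + (2 * l - 1 - 2 * r) * logΓ₂ ((s + l + r) / l))
      + ∑ r ∈ Finset.range l, (2 * (l : ℂ) * logΓ₂ ((s + l + r) / l)
        - (2 * l - 1 - 2 * r) * logΓ ((s + l + r) / l)) := by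
    rw [← Finset.sum_add_distrib]
    refine Finset.sum_congr rfl fun r _ => ?_
    have hw := re_add_natCast_div_pos hl hy r
    have e : (s + l + l + r) / (l : ℂ) = (s + l + r) / l + 1 := by
      field_simp
      ring
    rw [e, logΓ₃_add_one hw, logΓ₂_add_one hw]
    ring
  rw [logF, logF, logG, hsum]
  linear_combination h

theorem differentiable_expoF (l : ℕ) : Differentiable ℂ (expoF l) := by
  unfold expoF
  simp only [div_eq_mul_inv]
  fun_prop

theorem differentiableOn_comp_add_div {f : ℂ → ℂ} (hf : DifferentiableOn ℂ f {w : ℂ | 0 < w.re})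
    {l : ℕ} (hl : 1 ≤ l) (r : ℕ) :
    DifferentiableOn ℂ (fun s => f ((s + l + r) / l)) {s : ℂ | -(l : ℝ) < s.re} := by
  refine hf.comp (f := fun s : ℂ => (s + l + r) / (l : ℂ)) ?_ fun s hs =>
    re_add_natCast_div_pos hl (re_add_pos hs) r
  simp only [div_eq_mul_inv]
  fun_prop

theorem differentiableOn_logF {l : ℕ} (hl : 1 ≤ l) :
    DifferentiableOn ℂ (logF l) {s : ℂ | -(l : ℝ) < s.re} := by
  refine (differentiable_expoF l).differentiableOn.add (DifferentiableOn.fun_sum fun r _ => ?_)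
  exact ((differentiableOn_comp_add_div differentiableOn_logΓ₃ hl r).const_mul _).add
    ((differentiableOn_comp_add_div differentiableOn_logΓ₂ hl r).const_mul _)

theorem differentiableOn_two_mul_logΓ₂_sub :
    DifferentiableOn ℂ (fun s => 2 * logΓ₂ s - logΓ s) {s : ℂ | 0 < s.re} :=
  (differentiableOn_logΓ₂.const_mul _).sub differentiableOn_logΓ

theorem differentiableOn_logG : DifferentiableOn ℂ logG {s : ℂ | 0 < s.re} :=
  (by fun_prop : DifferentiableOn ℂ (fun s : ℂ => s * ((Real.log (2 * Real.pi) : ℝ) : ℂ))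
    {s : ℂ | 0 < s.re}).add differentiableOn_two_mul_logΓ₂_sub

theorem im_logF_one {l : ℕ} (hl : 1 ≤ l) : (logF l 1).im = 0 := by
  have hE : (expoF l 1).im = 0 := by
    rw [← Complex.conj_eq_iff_im]
    simp only [expoF, map_sub, map_add, map_mul, map_div₀, map_neg, Complex.conj_ofReal,
      map_natCast, map_one, map_ofNat]
  rw [logF, Complex.add_im, hE, zero_add, Complex.im_sum]
  refine Finset.sum_eq_zero fun r _ => ?_
  have hlpos : (0 : ℝ) < l := by exact_mod_cast hl
  have e : ((1 : ℂ) + l + r) / l = (((1 + l + r) / l : ℝ) : ℂ) := by push_cast; rfl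
  have hx : (0 : ℝ) < (1 + l + r) / l := by positivity
  have e1 : (-(2 * (l : ℂ))) = ((-(2 * l) : ℝ) : ℂ) := by push_cast; rfl
  have e2 : (2 * (l : ℂ) - 1 - 2 * r) = ((2 * l - 1 - 2 * r : ℝ) : ℂ) := by push_cast; rfl
  rw [e, e1, e2, Complex.add_im, Complex.im_ofReal_mul, Complex.im_ofReal_mul, im_logΓ₂_ofReal hx,
    im_logΓ₃_ofReal hx]
  simp

theorem logBranch_F {l : ℕ} (hl : 1 ≤ l) {s : ℂ} (hs : -(l : ℝ) < s.re) :
    logBranch (F l) s = logF l s :=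
  logBranch_eq (isOpen_re_gt _) (convex_halfSpace_re_gt _)
    (by
      have : (0 : ℝ) ≤ l := Nat.cast_nonneg l
      simp only [Set.mem_ofPred_eq, Complex.one_re]
      linarith)
    (differentiableOn_logF hl) (fun _ hw => exp_logF hl hw) (im_logF_one hl) hs

theorem logBranch_Gamma₂ {s : ℂ} (hs : 0 < s.re) :
    logBranch (fun w => Gamma₂ w ^ 2 / Complex.Gamma w) s = 2 * logΓ₂ s - logΓ s :=
  logBranch_eq (Φ := fun s => 2 * logΓ₂ s - logΓ s) (isOpen_re_gt 0) (convex_halfSpace_re_gt 0)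
    (by simp) differentiableOn_two_mul_logΓ₂_sub (fun _ hw => exp_two_mul_logΓ₂_sub hw)
    (by simp [logΓ_one, logΓ₂_one]) hs

/-! ### The mean defect of `logF` as a series -/

/-- `1 / y ^ 2` minus its mean over the interval of length `l` around `y`. -/
noncomputable def invSqDefect (l : ℕ) (y : ℂ) : ℂ :=
  1 / y ^ 2 - 1 / l * (1 / (y - l / 2) - 1 / (y + l / 2))

theorem deriv_comp_add_div {f : ℂ → ℂ} {l : ℕ} (r : ℕ) (s : ℂ) :
    deriv (fun s => f ((s + l + r) / l)) s = 1 / l * deriv f ((s + l + r) / l) := by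
  have e : (fun s : ℂ => f ((s + l + r) / l))
      = fun s => (fun u => f (u + (l + r) / l)) ((l : ℂ)⁻¹ * s) := by
    funext s
    congr 1
    ring
  rw [e, deriv_comp_mul_left (l : ℂ)⁻¹ (fun u => f (u + (l + r) / l)) s, deriv_comp_add_const,
    smul_eq_mul, one_div]
  congr 2
  ring

theorem expoF_eq_cubic (l : ℕ) : ∃ a b c : ℂ, expoF l = fun s => a * s ^ 3 + b * s ^ 2 + c * s := by
  refine ⟨-(2 / (6 * l) * (Real.log l : ℝ)), (Real.log (2 * Real.pi) : ℝ) / 2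
    + (3 - 3 * l) / (6 * l) * (Real.log l : ℝ),
    -(Real.log (k₂ l ^ (-2 : ℤ) * k₁ l) : ℝ) / l + l * (Real.log (2 * Real.pi) : ℝ) / 2
      + l * (3 - l) / (6 * l) * (Real.log l : ℝ), ?_⟩
  funext s
  rw [expoF]
  ring

/-- The exponent is a cubic in `s`, and cubics have no mean defect. -/
theorem expoF_meanDefect {l : ℕ} (hl : 1 ≤ l) (s : ℂ) :
    deriv (deriv (expoF l)) s
      - 1 / l * (deriv (expoF l) (s + l / 2) - deriv (expoF l) (s - l / 2)) = 0 := by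
  have hl0 : (l : ℂ) ≠ 0 := by exact_mod_cast (by omega : l ≠ 0)
  obtain ⟨a, b, c, h⟩ := expoF_eq_cubic l
  have h1 : deriv (expoF l) = fun s => 3 * a * s ^ 2 + 2 * b * s + c := by
    funext s
    rw [h]
    have hid := hasDerivAt_id s
    have := ((((hid.pow 3).const_mul a).add ((hid.pow 2).const_mul b)).add (hid.const_mul c))
    refine (this.congr_deriv ?_).deriv
    simp only [id]
    push_cast
    ring
  have h2 : deriv (deriv (expoF l)) s = 6 * a * s + 2 * b := by
    rw [h1]
    have hid := hasDerivAt_id s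
    have := ((((hid.pow 2).const_mul (3 * a)).add (hid.const_mul (2 * b))).add_const c)
    refine (this.congr_deriv ?_).deriv
    simp only [id]
    push_cast
    ring
  rw [h2, h1]
  field_simp
  ring

theorem deriv_logF {l : ℕ} (hl : 1 ≤ l) {s : ℂ} (hs : -(l : ℝ) < s.re) :
    deriv (logF l) s = deriv (expoF l) s + ∑ r ∈ Finset.range l,
      (-(2 * (l : ℂ)) * (1 / l * deriv logΓ₃ ((s + l + r) / l))
        + (2 * l - 1 - 2 * r) * (1 / l * deriv logΓ₂ ((s + l + r) / l))) := by
  have hmem := (isOpen_re_gt (-(l : ℝ))).mem_nhds hs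
  have hd3 := fun r => ((differentiableOn_comp_add_div differentiableOn_logΓ₃ hl r).differentiableAt
    hmem).hasDerivAt
  have hd2 := fun r => ((differentiableOn_comp_add_div differentiableOn_logΓ₂ hl r).differentiableAt
    hmem).hasDerivAt
  simp only [deriv_comp_add_div] at hd2 hd3
  exact (((differentiable_expoF l) s).hasDerivAt.add (HasDerivAt.fun_sum fun r _ =>
    ((hd3 r).const_mul (-(2 * (l : ℂ)))).add ((hd2 r).const_mul (2 * (l : ℂ) - 1 - 2 * r)))).deriv

theorem differentiable_deriv_expoF (l : ℕ) : Differentiable ℂ (deriv (expoF l)) := by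
  exact ((differentiable_expoF l).contDiff (n := 2)).differentiable_deriv_two

theorem deriv_deriv_logF {l : ℕ} (hl : 1 ≤ l) {s : ℂ} (hs : -(l : ℝ) < s.re) :
    deriv (deriv (logF l)) s = deriv (deriv (expoF l)) s + ∑ r ∈ Finset.range l,
      (-(2 * (l : ℂ)) * (1 / l * (1 / l * deriv (deriv logΓ₃) ((s + l + r) / l)))
        + (2 * l - 1 - 2 * r) * (1 / l * (1 / l * deriv (deriv logΓ₂) ((s + l + r) / l)))) := by
  have hmem := (isOpen_re_gt (-(l : ℝ))).mem_nhds hs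
  have hev : deriv (logF l) =ᶠ[𝓝 s] fun s => deriv (expoF l) s + ∑ r ∈ Finset.range l,
      (-(2 * (l : ℂ)) * (1 / l * deriv logΓ₃ ((s + l + r) / l))
        + (2 * l - 1 - 2 * r) * (1 / l * deriv logΓ₂ ((s + l + r) / l))) := by
    filter_upwards [hmem] with u hu using deriv_logF hl hu
  rw [hev.deriv_eq]
  have hd3 := fun r => ((differentiableOn_comp_add_div
    (differentiableOn_logΓ₃.deriv re_pos_isOpen) hl r).differentiableAt hmem).hasDerivAt
  have hd2 := fun r => ((differentiableOn_comp_add_div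
    (differentiableOn_logΓ₂.deriv re_pos_isOpen) hl r).differentiableAt hmem).hasDerivAt
  simp only [deriv_comp_add_div] at hd2 hd3
  exact ((differentiable_deriv_expoF l s).hasDerivAt.add (HasDerivAt.fun_sum fun r _ =>
    (((hd3 r).const_mul (1 / (l : ℂ))).const_mul (-(2 * (l : ℂ)))).add
      (((hd2 r).const_mul (1 / (l : ℂ))).const_mul (2 * (l : ℂ) - 1 - 2 * r)))).deriv

/-- The weights combine as `-2 l · (n + 1) (n + 2) / 2 + (2 l - 1 - 2 r) (n + 1) = -(n + 1) (l n + 2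
r + 1)`. Rescaling the unit interval around `(s + l + r) / l + n` to length `l` cancels the factor
`1 / l²` from the chain rule. -/
theorem tendsto_logF_meanDefect {l : ℕ} (hl : 1 ≤ l) {s : ℂ} (hs : -(l : ℝ) / 2 < s.re) :
    Tendsto (fun N => ∑ n ∈ Finset.range N, ∑ r ∈ Finset.range l,
      -(((n : ℂ) + 1) * (l * n + 2 * r + 1)) * invSqDefect l (s + l + r + l * n)) atTop
      (𝓝 (deriv (deriv (logF l)) s
        - 1 / l * (deriv (logF l) (s + l / 2) - deriv (logF l) (s - l / 2)))) := by
  have hl0 : (l : ℂ) ≠ 0 := by exact_mod_cast (by omega : l ≠ 0)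
  have hlpos : (0 : ℝ) < l := by exact_mod_cast hl
  have hw : ∀ r : ℕ, 1 / 2 < ((s + l + r) / (l : ℂ)).re := by
    intro r
    rw [show (l : ℂ) = ((l : ℝ) : ℂ) by simp, Complex.div_ofReal_re, lt_div_iff₀ hlpos]
    simp only [Complex.add_re, Complex.natCast_re, Complex.ofReal_re]
    have : (0 : ℝ) ≤ r := Nat.cast_nonneg r
    linarith
  have hlim : Tendsto (fun N => ∑ r ∈ Finset.range l, (-(2 * (l : ℂ)) * (1 / (l : ℂ) ^ 2
      * ∑ n ∈ Finset.range N, ((n : ℂ) + 1) * (n + 2) / 2 * (1 / ((s + l + r) / l + n) ^ 2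
        - 1 / ((s + l + r) / l - 1 / 2 + n) + 1 / ((s + l + r) / l + 1 / 2 + n)))
      + (2 * l - 1 - 2 * r) * (1 / (l : ℂ) ^ 2
      * ∑ n ∈ Finset.range N, ((n : ℂ) + 1) * (1 / ((s + l + r) / l + n) ^ 2
        - 1 / ((s + l + r) / l - 1 / 2 + n) + 1 / ((s + l + r) / l + 1 / 2 + n))))) atTop
      (𝓝 (∑ r ∈ Finset.range l, (-(2 * (l : ℂ)) * (1 / (l : ℂ) ^ 2
        * meanDefect logΓ₃ ((s + l + r) / l))
        + (2 * l - 1 - 2 * r) * (1 / (l : ℂ) ^ 2 * meanDefect logΓ₂ ((s + l + r) / l))))) :=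
    tendsto_finsetSum _ fun r _ =>
      (((tendsto_meanDefect_logΓ₃ (hw r)).const_mul _).const_mul _).add
        (((tendsto_meanDefect_logΓ₂ (hw r)).const_mul _).const_mul _)
  have hval : ∑ r ∈ Finset.range l, (-(2 * (l : ℂ)) * (1 / (l : ℂ) ^ 2
        * meanDefect logΓ₃ ((s + l + r) / l))
        + (2 * l - 1 - 2 * r) * (1 / (l : ℂ) ^ 2 * meanDefect logΓ₂ ((s + l + r) / l)))
      = deriv (deriv (logF l)) s
        - 1 / l * (deriv (logF l) (s + l / 2) - deriv (logF l) (s - l / 2)) := by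
    have hp : -(l : ℝ) < (s + l / 2).re := by
      rw [show (l : ℂ) / 2 = ((l / 2 : ℝ) : ℂ) by push_cast; rfl]
      simp only [Complex.add_re, Complex.ofReal_re]
      linarith
    have hm : -(l : ℝ) < (s - l / 2).re := by
      rw [show (l : ℂ) / 2 = ((l / 2 : ℝ) : ℂ) by push_cast; rfl]
      simp only [Complex.sub_re, Complex.ofReal_re]
      linarith
    have ep : ∀ r : ℕ, (s + l / 2 + l + r) / (l : ℂ) = (s + l + r) / l + 1 / 2 := by
      intro r; field_simp; ring
    have em : ∀ r : ℕ, (s - l / 2 + l + r) / (l : ℂ) = (s + l + r) / l - 1 / 2 := by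
      intro r; field_simp; ring
    rw [deriv_deriv_logF hl (by linarith), deriv_logF hl hp, deriv_logF hl hm]
    have h0 := expoF_meanDefect hl s
    simp only [ep, em]
    have hs : ∀ A B C : ℕ → ℂ, (∑ r ∈ Finset.range l, A r) - 1 / (l : ℂ)
        * ((∑ r ∈ Finset.range l, B r) - ∑ r ∈ Finset.range l, C r)
        = ∑ r ∈ Finset.range l, (A r - 1 / l * (B r - C r)) := by
      intro A B C
      rw [← Finset.sum_sub_distrib, Finset.mul_sum, ← Finset.sum_sub_distrib]
    have hs' := hs (fun r => -(2 * (l : ℂ)) * (1 / l * (1 / l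
        * deriv (deriv logΓ₃) ((s + l + r) / l)))
        + (2 * l - 1 - 2 * r) * (1 / l * (1 / l * deriv (deriv logΓ₂) ((s + l + r) / l))))
      (fun r => -(2 * (l : ℂ)) * (1 / l * deriv logΓ₃ ((s + l + r) / l + 1 / 2))
        + (2 * l - 1 - 2 * r) * (1 / l * deriv logΓ₂ ((s + l + r) / l + 1 / 2)))
      (fun r => -(2 * (l : ℂ)) * (1 / l * deriv logΓ₃ ((s + l + r) / l - 1 / 2))
        + (2 * l - 1 - 2 * r) * (1 / l * deriv logΓ₂ ((s + l + r) / l - 1 / 2)))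
    have hs'' : ∑ r ∈ Finset.range l, (-(2 * (l : ℂ)) * (1 / (l : ℂ) ^ 2
        * meanDefect logΓ₃ ((s + l + r) / l))
        + (2 * l - 1 - 2 * r) * (1 / (l : ℂ) ^ 2 * meanDefect logΓ₂ ((s + l + r) / l))) = _ :=
      (Finset.sum_congr rfl fun r _ => by simp only [meanDefect]; ring).trans hs'.symm
    rw [hs'']
    linear_combination -h0
  rw [← hval]
  refine hlim.congr fun N => ?_
  rw [Finset.sum_comm]
  refine Finset.sum_congr rfl fun r _ => ?_
  simp only [Finset.mul_sum, ← Finset.sum_add_distrib]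
  refine Finset.sum_congr rfl fun n _ => ?_
  have e0 : (s + l + r) / l + n = (s + l + r + l * n) / (l : ℂ) := by field_simp
  have e1 : (s + l + r) / l - 1 / 2 + n = (s + l + r + l * n - l / 2) / (l : ℂ) := by
    field_simp; ring
  have e2 : (s + l + r) / l + 1 / 2 + n = (s + l + r + l * n + l / 2) / (l : ℂ) := by
    field_simp; ring
  rw [e0, e1, e2, invSqDefect, div_pow, one_div_div, one_div_div, one_div_div]
  field_simp
  ring

/-- This is the ladder relation differentiated at `s - l/2`. -/
theorem deriv_logG {l : ℕ} (hl : 1 ≤ l) {s : ℂ} (hs : -(l : ℝ) / 2 < s.re) :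
    deriv logG (s + l / 2) = deriv (logF l) (s + l / 2) - deriv (logF l) (s - l / 2) := by
  have hlpos : (0 : ℝ) < l := by exact_mod_cast hl
  have hm : -(l : ℝ) < (s - l / 2).re := by
    rw [show (l : ℂ) / 2 = ((l / 2 : ℝ) : ℂ) by push_cast; rfl]
    simp only [Complex.sub_re, Complex.ofReal_re]
    linarith
  have hp : 0 < (s + l / 2).re := by
    rw [show (l : ℂ) / 2 = ((l / 2 : ℝ) : ℂ) by push_cast; rfl]
    simp only [Complex.add_re, Complex.ofReal_re]
    linarith
  have hev : (fun u => logF l (u + l)) =ᶠ[𝓝 (s - l / 2)] fun u => logF l u + logG (u + l) := by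
    filter_upwards [(isOpen_re_gt (-(l : ℝ))).mem_nhds hm] with u hu using logF_add hl hu
  have e : s - (l : ℂ) / 2 + l = s + l / 2 := by ring
  have h := hev.deriv_eq
  have hdG : DifferentiableAt ℂ (fun u => logG (u + l)) (s - l / 2) := by
    refine DifferentiableAt.comp (g := logG) _ ?_ (by fun_prop)
    rw [e]
    exact differentiableOn_logG.differentiableAt ((isOpen_re_gt 0).mem_nhds hp)
  rw [deriv_fun_add ((differentiableOn_logF hl).differentiableAt
    ((isOpen_re_gt (-(l : ℝ))).mem_nhds hm)) hdG, deriv_comp_add_const, deriv_comp_add_const, e] at h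
  rw [h]
  ring

/-! ### Integrals of simple fractions over the real line -/

theorem add_I_mul_ne_zero {a : ℂ} (ha : 0 < a.re) (r : ℝ) : a + Complex.I * r ≠ 0 := by
  intro h
  have := congrArg Complex.re h
  simp at this
  linarith

theorem exists_le_norm_add {l : ℕ} (hl : 1 ≤ l) {a : ℂ} (ha : 0 < a.re) :
    ∃ K : ℝ, 0 < K ∧ ∀ (m : ℕ) (r : ℝ), 1 + m + |r| ≤ K * ‖a + l * m + Complex.I * r‖ := by
  -- `‖z‖ ≥ Re a` pays for `1 + |Im a|` through the quotient; `m` and `|Im a + r|` cost one `‖z‖`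
  -- each.
  refine ⟨(1 + |a.im|) / a.re + 2, by positivity, fun m r => ?_⟩
  have hl' : (1 : ℝ) ≤ l := by exact_mod_cast hl
  have hm : (0 : ℝ) ≤ m := Nat.cast_nonneg m
  set z := a + l * m + Complex.I * r with hz
  have hre : z.re = a.re + l * m := by simp [hz]
  have him : z.im = a.im + r := by simp [hz]
  have h1 : a.re + l * m ≤ ‖z‖ := hre ▸ Complex.re_le_norm z
  have h2 : |a.im + r| ≤ ‖z‖ := him ▸ Complex.abs_im_le_norm z
  have h3 : |r| ≤ |a.im + r| + |a.im| := by
    calc |r| = |(a.im + r) - a.im| := by ring_nf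
      _ ≤ _ := abs_sub _ _
  have h4 : (1 + |a.im|) ≤ (1 + |a.im|) / a.re * ‖z‖ := by
    rw [div_mul_eq_mul_div, le_div_iff₀ ha]
    have : a.re ≤ ‖z‖ := by nlinarith
    gcongr
  have h5 : (m : ℝ) ≤ ‖z‖ := by nlinarith
  linarith

theorem continuous_inv_add_I_mul {a : ℂ} (ha : 0 < a.re) :
    Continuous fun r : ℝ => (a + Complex.I * r)⁻¹ :=
  (by fun_prop : Continuous fun r : ℝ => a + Complex.I * r).inv₀ (add_I_mul_ne_zero ha)

theorem hasDerivAt_add_I_mul (a : ℂ) (r : ℝ) :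
    HasDerivAt (fun r : ℝ => a + Complex.I * (r : ℂ)) Complex.I r := by
  simpa using ((hasDerivAt_id (r : ℂ)).const_mul Complex.I |>.const_add a).comp_ofReal

theorem integrable_inv_mul_inv {a c : ℂ} (ha : 0 < a.re) (hc : 0 < c.re) :
    Integrable fun r : ℝ => (a + Complex.I * r)⁻¹ * (c + Complex.I * r)⁻¹ := by
  obtain ⟨K, hK, h⟩ := exists_le_norm_add le_rfl ha
  obtain ⟨K', hK', h'⟩ := exists_le_norm_add le_rfl hc
  refine (integrable_inv_one_add_sq.const_mul (K * K')).mono'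
    ((continuous_inv_add_I_mul ha).mul (continuous_inv_add_I_mul hc)).aestronglyMeasurable
    (Eventually.of_forall fun r => ?_)
  have h1 := h 0 r
  have h2 := h' 0 r
  simp only [Nat.cast_zero, mul_zero, add_zero] at h1 h2
  have p1 : 0 < ‖a + Complex.I * r‖ := norm_pos_iff.2 (add_I_mul_ne_zero ha r)
  have p2 : 0 < ‖c + Complex.I * r‖ := norm_pos_iff.2 (add_I_mul_ne_zero hc r)
  rw [norm_mul, norm_inv, norm_inv, ← mul_inv, ← div_eq_mul_inv, inv_le_iff_one_le_mul₀ (by positivity),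
    div_mul_eq_mul_div, le_div_iff₀ (by positivity), one_mul]
  have h3 : 1 + r ^ 2 ≤ (1 + |r|) * (1 + |r|) := by
    nlinarith [abs_nonneg r, sq_abs r]
  calc 1 + r ^ 2 ≤ (1 + |r|) * (1 + |r|) := h3
    _ ≤ (K * ‖a + Complex.I * r‖) * (K' * ‖c + Complex.I * r‖) := by gcongr
    _ = _ := by ring

theorem integrable_inv_mul_inv_mul_inv {a c b : ℂ} (ha : 0 < a.re) (hc : 0 < c.re)
    (hb : 0 < b.re) :
    Integrable fun r : ℝ =>
      (a + Complex.I * r)⁻¹ * (c + Complex.I * r)⁻¹ * (b + Complex.I * r)⁻¹ := by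
  refine (integrable_inv_mul_inv ha hc).mul_bdd (c := b.re⁻¹)
    (continuous_inv_add_I_mul hb).aestronglyMeasurable (Eventually.of_forall fun r => ?_)
  rw [norm_inv]
  refine inv_anti₀ hb ?_
  have := Complex.re_le_norm (b + Complex.I * r)
  simpa using this

theorem tendsto_norm_add_I_mul (a : ℂ) {f : Filter ℝ} (hf : Tendsto (fun r : ℝ => |r|) f atTop) :
    Tendsto (fun r : ℝ => (a + Complex.I * r)⁻¹) f (𝓝 0) := by
  refine tendsto_inv₀_cobounded.comp (tendsto_norm_atTop_iff_cobounded.1 ?_)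
  refine tendsto_atTop_mono (fun r => ?_) (tendsto_atTop_add_const_right f (-‖a‖) hf)
  have : ‖Complex.I * (r : ℂ)‖ - ‖a‖ ≤ ‖a + Complex.I * r‖ := by
    have := norm_sub_le (a + Complex.I * (r : ℂ)) a
    rw [add_sub_cancel_left] at this
    linarith
  simpa [sub_eq_add_neg] using this

theorem tendsto_log_sub_log_aux {ε : ℂ} (hε : ε ∈ Complex.slitPlane) (a c : ℂ) :
    Tendsto (fun r : ℝ => Complex.log (ε + a / r) - Complex.log (ε + c / r)) atTop (𝓝 0) := by
  have h : ∀ a : ℂ, Tendsto (fun r : ℝ => Complex.log (ε + a / r)) atTop (𝓝 (Complex.log ε)) := by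
    intro a
    have h1 : Tendsto (fun r : ℝ => ((r : ℂ))⁻¹) atTop (𝓝 0) := by
      have := (Complex.continuous_ofReal.tendsto 0).comp tendsto_inv_atTop_zero
      simpa [Function.comp_def] using this
    have h2 : Tendsto (fun r : ℝ => ε + a / r) atTop (𝓝 ε) := by
      simpa [div_eq_mul_inv] using (h1.const_mul a).const_add ε
    exact ((continuousAt_clog hε).tendsto).comp h2
  simpa using (h a).sub (h c)

/-- Factoring out `r > 0` leaves `log (I + a / r)`, which tends to `log I` for every `a`; the terms
`log r` cancel. -/
theorem tendsto_log_sub_log_atTop {a c : ℂ} (ha : 0 < a.re) (hc : 0 < c.re) :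
    Tendsto (fun r : ℝ => Complex.log (a + Complex.I * r) - Complex.log (c + Complex.I * r)) atTop
      (𝓝 0) := by
  refine (tendsto_log_sub_log_aux (ε := Complex.I) (by simp [Complex.mem_slitPlane_iff]) a c).congr'
    ?_
  filter_upwards [eventually_gt_atTop 0] with r hr
  have h : ∀ a : ℂ, 0 < a.re →
      Complex.log (a + Complex.I * r) = Real.log r + Complex.log (Complex.I + a / r) := by
    intro a ha
    have e : a + Complex.I * r = (r : ℂ) * (Complex.I + a / r) := by
      have : (r : ℂ) ≠ 0 := by exact_mod_cast hr.ne'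
      field_simp
      ring
    have hne : Complex.I + a / r ≠ 0 := by
      intro h0
      rw [h0, mul_zero] at e
      exact add_I_mul_ne_zero ha r e
    rw [e, Complex.log_ofReal_mul hr hne]
  rw [h a ha, h c hc]
  ring

theorem tendsto_log_sub_log_atBot {a c : ℂ} (ha : 0 < a.re) (hc : 0 < c.re) :
    Tendsto (fun r : ℝ => Complex.log (a + Complex.I * r) - Complex.log (c + Complex.I * r)) atBot
      (𝓝 0) := by
  rw [← tendsto_comp_neg_atTop_iff]
  refine (tendsto_log_sub_log_aux (ε := -Complex.I) (by simp [Complex.mem_slitPlane_iff]) a c).congr'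
    ?_
  filter_upwards [eventually_gt_atTop 0] with r hr
  have h : ∀ a : ℂ, 0 < a.re →
      Complex.log (a + Complex.I * (-r : ℝ)) = Real.log r + Complex.log (-Complex.I + a / r) := by
    intro a ha
    have e : a + Complex.I * (-r : ℝ) = (r : ℂ) * (-Complex.I + a / r) := by
      have : (r : ℂ) ≠ 0 := by exact_mod_cast hr.ne'
      push_cast
      field_simp
      ring
    have hne : -Complex.I + a / r ≠ 0 := by
      intro h0
      rw [h0, mul_zero] at e
      exact add_I_mul_ne_zero ha _ e
    rw [e, Complex.log_ofReal_mul hr hne]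
  rw [h a ha, h c hc]
  ring

/-- Both poles lie on the same side of the real line. An explicit primitive, a simple fraction if `a
= c` and a difference of logarithms otherwise, tends to zero at both ends. -/
theorem integral_inv_mul_inv {a c : ℂ} (ha : 0 < a.re) (hc : 0 < c.re) :
    ∫ r : ℝ, (a + Complex.I * r)⁻¹ * (c + Complex.I * r)⁻¹ = 0 := by
  rcases eq_or_ne a c with rfl | hac
  · have hd : ∀ r : ℝ, HasDerivAt (fun r : ℝ => Complex.I * (a + Complex.I * r)⁻¹)
        ((a + Complex.I * r)⁻¹ * (a + Complex.I * r)⁻¹) r := by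
      intro r
      have hne := add_I_mul_ne_zero ha r
      refine (((hasDerivAt_add_I_mul a r).inv hne).const_mul Complex.I).congr_deriv ?_
      field_simp
      simp
    have := integral_of_hasDerivAt_of_tendsto hd (integrable_inv_mul_inv ha ha)
      ((tendsto_norm_add_I_mul a tendsto_abs_atBot_atTop).const_mul Complex.I)
      ((tendsto_norm_add_I_mul a tendsto_abs_atTop_atTop).const_mul Complex.I)
    simpa using this
  · have hac' : c - a ≠ 0 := sub_ne_zero.2 hac.symm
    have hlog : ∀ a : ℂ, 0 < a.re → ∀ r : ℝ, HasDerivAt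
        (fun r : ℝ => Complex.log (a + Complex.I * r)) (Complex.I / (a + Complex.I * r)) r := by
      intro a ha r
      exact (hasDerivAt_add_I_mul a r).clog_real (Or.inl (by simpa using ha))
    have hd : ∀ r : ℝ, HasDerivAt (fun r : ℝ => -Complex.I / (c - a)
        * (Complex.log (a + Complex.I * r) - Complex.log (c + Complex.I * r)))
        ((a + Complex.I * r)⁻¹ * (c + Complex.I * r)⁻¹) r := by
      intro r
      have h1 := add_I_mul_ne_zero ha r
      have h2 := add_I_mul_ne_zero hc r
      refine (((hlog a ha r).sub (hlog c hc r)).const_mul (-Complex.I / (c - a))).congr_deriv ?_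
      field_simp
      ring_nf
      simp only [Complex.I_sq]
      ring
    have := integral_of_hasDerivAt_of_tendsto hd (integrable_inv_mul_inv ha hc)
      ((tendsto_log_sub_log_atBot ha hc).const_mul _) ((tendsto_log_sub_log_atTop ha hc).const_mul _)
    simpa using this

theorem integral_inv_mul_inv_mul_inv_of_ne {a c b : ℂ} (ha : 0 < a.re) (hc : 0 < c.re)
    (hb : 0 < b.re) (hab : a ≠ b) :
    ∫ r : ℝ, (a + Complex.I * r)⁻¹ * (c + Complex.I * r)⁻¹ * (b + Complex.I * r)⁻¹ = 0 := by
  have hab' : b - a ≠ 0 := sub_ne_zero.2 hab.symm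
  have e : ∀ r : ℝ, (a + Complex.I * r)⁻¹ * (c + Complex.I * r)⁻¹ * (b + Complex.I * r)⁻¹
      = (b - a)⁻¹ * ((a + Complex.I * r)⁻¹ * (c + Complex.I * r)⁻¹
        - (b + Complex.I * r)⁻¹ * (c + Complex.I * r)⁻¹) := by
    intro r
    have h1 := add_I_mul_ne_zero ha r
    have h2 := add_I_mul_ne_zero hc r
    have h3 := add_I_mul_ne_zero hb r
    field_simp
    ring
  simp only [e]
  rw [integral_const_mul, integral_sub (integrable_inv_mul_inv ha hc) (integrable_inv_mul_inv hb hc),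
    integral_inv_mul_inv ha hc, integral_inv_mul_inv hb hc]
  simp

/-- If two of the parameters differ, a partial fraction step reduces to products of two factors; if
all three coincide, there is an elementary primitive. -/
theorem integral_inv_mul_inv_mul_inv {a c b : ℂ} (ha : 0 < a.re) (hc : 0 < c.re)
    (hb : 0 < b.re) :
    ∫ r : ℝ, (a + Complex.I * r)⁻¹ * (c + Complex.I * r)⁻¹ * (b + Complex.I * r)⁻¹ = 0 := by
  rcases ne_or_eq a b with hab | rfl
  · exact integral_inv_mul_inv_mul_inv_of_ne ha hc hb hab
  rcases ne_or_eq c a with hca | rfl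
  · rw [← integral_inv_mul_inv_mul_inv_of_ne hc ha ha hca]
    congr 1
    funext r
    ring
  have hd : ∀ r : ℝ, HasDerivAt (fun r : ℝ => Complex.I / 2 * ((c + Complex.I * r)⁻¹) ^ 2)
      ((c + Complex.I * r)⁻¹ * (c + Complex.I * r)⁻¹ * (c + Complex.I * r)⁻¹) r := by
    intro r
    have hne := add_I_mul_ne_zero hc r
    refine ((((hasDerivAt_add_I_mul c r).inv hne).pow 2).const_mul (Complex.I / 2)).congr_deriv ?_
    simp only [Pi.inv_apply, div_eq_mul_inv, ← inv_pow]
    push_cast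
    linear_combination (-((c + Complex.I * r)⁻¹) ^ 3) * Complex.I_sq
  have := integral_of_hasDerivAt_of_tendsto hd (integrable_inv_mul_inv_mul_inv hc hc hc)
    (((tendsto_norm_add_I_mul c tendsto_abs_atBot_atTop).pow 2).const_mul (Complex.I / 2))
    (((tendsto_norm_add_I_mul c tendsto_abs_atTop_atTop).pow 2).const_mul (Complex.I / 2))
  simpa using this

theorem integrable_inv_sq_add_sq {b : ℝ} (hb : 0 < b) :
    Integrable fun r : ℝ => (r ^ 2 + b ^ 2)⁻¹ := by
  refine ((integrable_inv_one_add_sq.comp_div hb.ne').const_mul (b ^ 2)⁻¹).congr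
    (Eventually.of_forall fun r => ?_)
  simp only
  rw [← mul_inv]
  congr 1
  field_simp
  ring

theorem integral_inv_sq_add_sq {b : ℝ} (hb : 0 < b) :
    ∫ r : ℝ, (r ^ 2 + b ^ 2)⁻¹ = Real.pi / b := by
  have e : ∀ r : ℝ, (r ^ 2 + b ^ 2)⁻¹ = (b ^ 2)⁻¹ * (1 + (r / b) ^ 2)⁻¹ := by
    intro r
    rw [← mul_inv]
    congr 1
    field_simp
    ring
  simp only [e]
  rw [integral_const_mul, Measure.integral_comp_div (fun x : ℝ => (1 + x ^ 2)⁻¹),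
    integral_univ_inv_one_add_sq, abs_of_pos hb, smul_eq_mul]
  field_simp

/-- Partial fractions that isolate `(r² + b²)⁻¹`, the only summand with poles on both sides of the
real line and so the only one with nonzero integral. -/
theorem inv_mul_inv_mul_div_eq {a c : ℂ} (ha : 0 < a.re) (hc : 0 < c.re) {b : ℝ} (hb : 0 < b)
    (r : ℝ) :
    (a + Complex.I * r)⁻¹ * (c + Complex.I * r)⁻¹ * ((r ^ 2 / (r ^ 2 + b ^ 2) : ℝ) : ℂ)
      = ((a + b) * (c + b))⁻¹ * ((a * c + (a + c) * b)
          * ((a + Complex.I * r)⁻¹ * (c + Complex.I * r)⁻¹)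
        - (a + c) * b ^ 2 * ((a + Complex.I * r)⁻¹ * (c + Complex.I * r)⁻¹
          * (b + Complex.I * r)⁻¹) - b ^ 2 * (((r ^ 2 + b ^ 2)⁻¹ : ℝ) : ℂ)) := by
  have h1 := add_I_mul_ne_zero ha r
  have h2 := add_I_mul_ne_zero hc r
  have h3 : (b : ℂ) + Complex.I * r ≠ 0 := add_I_mul_ne_zero (by simpa using hb) r
  have h3' : (b : ℂ) - Complex.I * r ≠ 0 := by
    have := add_I_mul_ne_zero (a := (b : ℂ)) (by simpa using hb) (-r)
    push_cast at this
    rwa [mul_neg, ← sub_eq_add_neg] at this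
  have h4 : a + b ≠ 0 := fun h => by
    have := congrArg Complex.re h
    simp at this
    linarith
  have h5 : c + b ≠ 0 := fun h => by
    have := congrArg Complex.re h
    simp at this
    linarith
  have hr : (r : ℂ) ^ 2 = -(Complex.I * r) ^ 2 := by
    rw [mul_pow, Complex.I_sq]
    ring
  have hfac : (r : ℂ) ^ 2 + (b : ℂ) ^ 2 = (b + Complex.I * r) * (b - Complex.I * r) := by
    rw [hr]
    ring
  push_cast
  rw [hfac, hr]
  generalize Complex.I * (r : ℂ) = u at *
  field_simp
  ring

theorem integrable_inv_mul_inv_mul_div {a c : ℂ} (ha : 0 < a.re) (hc : 0 < c.re) {b : ℝ}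
    (hb : 0 < b) :
    Integrable fun r : ℝ =>
      (a + Complex.I * r)⁻¹ * (c + Complex.I * r)⁻¹ * ((r ^ 2 / (r ^ 2 + b ^ 2) : ℝ) : ℂ) := by
  simp only [inv_mul_inv_mul_div_eq ha hc hb]
  exact ((((integrable_inv_mul_inv ha hc).const_mul _).sub ((integrable_inv_mul_inv_mul_inv ha hc
    (by simpa using hb)).const_mul _)).sub ((integrable_inv_sq_add_sq hb).ofReal.const_mul _)).const_mul _

theorem integral_inv_mul_inv_mul_div {a c : ℂ} (ha : 0 < a.re) (hc : 0 < c.re) {b : ℝ}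
    (hb : 0 < b) :
    ∫ r : ℝ, (a + Complex.I * r)⁻¹ * (c + Complex.I * r)⁻¹ * ((r ^ 2 / (r ^ 2 + b ^ 2) : ℝ) : ℂ)
      = -(Real.pi * b) * ((a + b) * (c + b))⁻¹ := by
  have hb' : 0 < (b : ℂ).re := by simpa using hb
  have hb0 : (b : ℂ) ≠ 0 := by exact_mod_cast hb.ne'
  simp only [inv_mul_inv_mul_div_eq ha hc hb]
  have h1 : Integrable fun r : ℝ => (a * c + (a + c) * b)
      * ((a + Complex.I * r)⁻¹ * (c + Complex.I * r)⁻¹) :=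
    (integrable_inv_mul_inv ha hc).const_mul _
  have h2 : Integrable fun r : ℝ => (a + c) * b ^ 2
      * ((a + Complex.I * r)⁻¹ * (c + Complex.I * r)⁻¹ * (b + Complex.I * r)⁻¹) :=
    (integrable_inv_mul_inv_mul_inv ha hc hb').const_mul _
  have h3 : Integrable fun r : ℝ => (b : ℂ) ^ 2 * (((r ^ 2 + b ^ 2)⁻¹ : ℝ) : ℂ) :=
    (integrable_inv_sq_add_sq hb).ofReal.const_mul _
  have h12 : Integrable fun r : ℝ => (a * c + (a + c) * b)
      * ((a + Complex.I * r)⁻¹ * (c + Complex.I * r)⁻¹) - (a + c) * b ^ 2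
      * ((a + Complex.I * r)⁻¹ * (c + Complex.I * r)⁻¹ * (b + Complex.I * r)⁻¹) := h1.sub h2
  rw [integral_const_mul, integral_sub h12 h3, integral_sub h1 h2,
    integral_const_mul, integral_const_mul, integral_const_mul, integral_inv_mul_inv ha hc,
    integral_inv_mul_inv_mul_inv ha hc hb', integral_complex_ofReal, integral_inv_sq_add_sq hb]
  push_cast
  field_simp
  ring

/-! ### Term-by-term integration of `φ_s (r) r tanh (π r)` -/

/-- The partial fraction expansion of `r * tanh (π r)`. -/
theorem hasSum_mul_tanh (r : ℝ) :
    HasSum (fun k : ℕ => r ^ 2 / (r ^ 2 + ((k : ℝ) + 1 / 2) ^ 2))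
      (Real.pi / 2 * (r * Real.tanh (Real.pi * r))) := by
  -- At this point `π x = π/2 - i π r`, so the cotangent becomes `i tanh (π r)`.
  set x : ℂ := 1 / 2 - Complex.I * r with hx
  have hxre : x.re = 1 / 2 := by simp [hx]
  have hxZ : x ∈ Complex.integerComplement := by
    rintro ⟨n, hn⟩
    have h := congrArg Complex.re hn
    rw [hxre, Complex.intCast_re] at h
    have : (2 * n : ℝ) = 1 := by linarith
    norm_cast at this
    omega
  have hpos : ∀ k : ℕ, x + k ≠ 0 := fun k => add_natCast_ne_zero k (by rw [hxre]; norm_num)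
  have hneg : ∀ k : ℕ, x - (k + 1) ≠ 0 := by
    intro k h
    have := congrArg Complex.re h
    simp [hxre] at this
    linarith [(Nat.cast_nonneg k : (0 : ℝ) ≤ k)]
  have h1 := tendsto_logDeriv_euler_cot_sub hxZ
  have h2 : Tendsto (fun n : ℕ => 1 / (x + n)) atTop (𝓝 0) := by
    obtain ⟨K, hK, h⟩ := exists_le_norm_add le_rfl (a := x) (by rw [hxre]; norm_num)
    refine squeeze_zero_norm (a := fun n : ℕ => K * (1 / ((n : ℝ) + 1))) (fun n => ?_) ?_
    · have h0 := h n 0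
      simp only [Nat.cast_one, one_mul, Complex.ofReal_zero, mul_zero, add_zero, abs_zero] at h0
      have p : 0 < ‖x + n‖ := norm_pos_iff.2 (hpos n)
      rw [norm_div, norm_one, mul_one_div, div_le_div_iff₀ p (by positivity)]
      linarith
    · simpa using tendsto_one_div_add_atTop_nhds_zero_nat.const_mul K
  -- The cotangent series is regrouped to pair `x + k` with `x - (k + 1)`, whose product is `-(r² +
  -- (k + 1/2)²)`; the price is the boundary term `1 / (x + n)`, which tends to zero.
  have hpart : ∀ n : ℕ, ∑ k ∈ Finset.range n, (1 / (x + k) + 1 / (x - (k + 1)))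
      = 1 / x + ∑ j ∈ Finset.range n, (1 / (x - (j + 1)) + 1 / (x + (j + 1))) - 1 / (x + n) := by
    intro n
    induction n with
    | zero => simp
    | succ n ih =>
      rw [Finset.sum_range_succ, Finset.sum_range_succ, ih]
      push_cast
      ring
  have h3 : Tendsto (fun n : ℕ => ∑ k ∈ Finset.range n, (1 / (x + k) + 1 / (x - (k + 1)))) atTop
      (𝓝 (Real.pi * Complex.cot (Real.pi * x))) := by
    have := (h1.const_add (1 / x)).sub h2
    rw [show 1 / x + (Real.pi * Complex.cot (Real.pi * x) - 1 / x) - 0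
      = Real.pi * Complex.cot (Real.pi * x) by ring] at this
    exact this.congr fun n => (hpart n).symm
  have hcot : Complex.cot (Real.pi * x) = Complex.I * (Real.tanh (Real.pi * r) : ℝ) := by
    have e : (Real.pi : ℂ) * x = Real.pi / 2 - (Real.pi * r : ℝ) * Complex.I := by
      rw [hx]
      push_cast
      ring
    rw [e, Complex.cot, Complex.cos_pi_div_two_sub, Complex.sin_pi_div_two_sub, Complex.sin_mul_I,
      Complex.cos_mul_I, Complex.ofReal_tanh, Complex.tanh_eq_sinh_div_cosh]
    ring
  rw [hasSum_iff_tendsto_nat_of_nonneg (fun k => by positivity)]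
  rw [hcot] at h3
  have h4 := (Complex.continuous_re.tendsto _).comp (h3.const_mul (-Complex.I * r / 2))
  have e : (-Complex.I * r / 2 * (Real.pi * (Complex.I * (Real.tanh (Real.pi * r) : ℝ)))).re
      = Real.pi / 2 * (r * Real.tanh (Real.pi * r)) := by
    have : -Complex.I * r / 2 * (Real.pi * (Complex.I * (Real.tanh (Real.pi * r) : ℝ)))
        = ((Real.pi / 2 * (r * Real.tanh (Real.pi * r)) : ℝ) : ℂ) := by
      push_cast
      linear_combination (-(r : ℂ) / 2 * Real.pi * Complex.tanh (Real.pi * r)) * Complex.I_sq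
    rw [this, Complex.ofReal_re]
  rw [e] at h4
  refine h4.congr fun n => ?_
  simp only [Function.comp, Finset.mul_sum]
  rw [Complex.re_sum]
  refine Finset.sum_congr rfl fun k _ => ?_
  have hk : (0 : ℝ) < r ^ 2 + ((k : ℝ) + 1 / 2) ^ 2 := by positivity
  have hfac : (x + k) * (x - (k + 1)) = -((r ^ 2 + ((k : ℝ) + 1 / 2) ^ 2 : ℝ) : ℂ) := by
    rw [hx]
    push_cast
    linear_combination (r : ℂ) ^ 2 * Complex.I_sq
  have : -Complex.I * r / 2 * (1 / (x + k) + 1 / (x - (k + 1)))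
      = ((r ^ 2 / (r ^ 2 + ((k : ℝ) + 1 / 2) ^ 2) : ℝ) : ℂ) := by
    have hnum : 1 * (x - (k + 1)) + (x + k) * 1 = -2 * Complex.I * r := by
      rw [hx]
      ring
    rw [div_add_div _ _ (hpos k) (hneg k), hfac, hnum, Complex.ofReal_div, Complex.ofReal_pow]
    generalize ((r ^ 2 + ((k : ℝ) + 1 / 2) ^ 2 : ℝ) : ℂ) = D
    rw [div_neg]
    linear_combination (-(r : ℂ) ^ 2 / D) * Complex.I_sq
  rw [this, Complex.ofReal_re]

/-- The summand of `φ_s (r)`. -/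
noncomputable def phiTerm (l : ℕ) (s : ℂ) (m : ℕ) (r : ℝ) : ℂ :=
  1 / (s + l * m + l - 1 / 2 + Complex.I * r) ^ 2
    - 1 / l * (1 / (s + l * m + l / 2 - 1 / 2 + Complex.I * r))
    + 1 / l * (1 / (s + l * m + 3 * l / 2 - 1 / 2 + Complex.I * r))

theorem re_pos_of_lt {l : ℕ} (hl : 1 ≤ l) {s : ℂ} (hs : (1 - (l : ℝ)) / 2 < s.re) :
    0 < (s + l - 1 / 2).re ∧ 0 < (s + l / 2 - 1 / 2).re ∧ 0 < (s + 3 * l / 2 - 1 / 2).re := by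
  have hl' : (1 : ℝ) ≤ l := by exact_mod_cast hl
  rw [show s + l - 1 / 2 = s + ((l - 1 / 2 : ℝ) : ℂ) by push_cast; ring,
    show s + l / 2 - 1 / 2 = s + ((l / 2 - 1 / 2 : ℝ) : ℂ) by push_cast; ring,
    show s + 3 * l / 2 - 1 / 2 = s + ((3 * l / 2 - 1 / 2 : ℝ) : ℂ) by push_cast; ring]
  simp only [Complex.add_re, Complex.ofReal_re]
  refine ⟨?_, ?_, ?_⟩ <;> linarith

theorem re_add_mul_pos {a : ℂ} (ha : 0 < a.re) (l m : ℕ) : 0 < (a + l * m).re := by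
  rw [← Nat.cast_mul, Complex.add_re, Complex.natCast_re]
  positivity

/-- The summand of `φ_s (r)` as a combination of products of two simple fractions. -/
theorem phiTerm_eq {l : ℕ} (hl : 1 ≤ l) {s : ℂ} (hs : (1 - (l : ℝ)) / 2 < s.re) (m : ℕ) (r : ℝ) :
    phiTerm l s m r
      = (s + l - 1 / 2 + l * m + Complex.I * r)⁻¹ * (s + l - 1 / 2 + l * m + Complex.I * r)⁻¹
        - (s + l / 2 - 1 / 2 + l * m + Complex.I * r)⁻¹
          * (s + 3 * l / 2 - 1 / 2 + l * m + Complex.I * r)⁻¹ := by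
  have hl0 : (l : ℂ) ≠ 0 := by exact_mod_cast (by omega : l ≠ 0)
  obtain ⟨h1, h2, h3⟩ := re_pos_of_lt hl hs
  have n1 := add_I_mul_ne_zero (re_add_mul_pos h1 l m) r
  have n2 := add_I_mul_ne_zero (re_add_mul_pos h2 l m) r
  have n3 := add_I_mul_ne_zero (re_add_mul_pos h3 l m) r
  have e1 : s + l * m + l - 1 / 2 + Complex.I * r = s + l - 1 / 2 + l * m + Complex.I * r := by ring
  have e2 : s + l * m + l / 2 - 1 / 2 + Complex.I * r
      = s + l / 2 - 1 / 2 + l * m + Complex.I * r := by ring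
  have e3 : s + l * m + 3 * l / 2 - 1 / 2 + Complex.I * r
      = s + 3 * l / 2 - 1 / 2 + l * m + Complex.I * r := by ring
  have e4 : s + 3 * l / 2 - 1 / 2 + l * m + Complex.I * r
      = (s + l / 2 - 1 / 2 + l * m + Complex.I * r) + l := by ring
  rw [phiTerm, e1, e2, e3]
  rw [e4] at n3 ⊢
  generalize s + l / 2 - 1 / 2 + l * m + Complex.I * r = z at *
  field_simp
  ring

theorem phiTerm_eq_inv {l : ℕ} (hl : 1 ≤ l) {s : ℂ} (hs : (1 - (l : ℝ)) / 2 < s.re) (m : ℕ)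
    (r : ℝ) :
    phiTerm l s m r = -((l : ℂ) ^ 2 / 4)
      * ((s + l - 1 / 2 + l * m + Complex.I * r) * (s + l - 1 / 2 + l * m + Complex.I * r)
        * (s + l / 2 - 1 / 2 + l * m + Complex.I * r)
          * (s + 3 * l / 2 - 1 / 2 + l * m + Complex.I * r))⁻¹ := by
  obtain ⟨h1, h2, h3⟩ := re_pos_of_lt hl hs
  have n1 := add_I_mul_ne_zero (re_add_mul_pos h1 l m) r
  have n2 := add_I_mul_ne_zero (re_add_mul_pos h2 l m) r
  have n3 := add_I_mul_ne_zero (re_add_mul_pos h3 l m) r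
  have e2 : s + l / 2 - 1 / 2 + l * m + Complex.I * r
      = (s + l - 1 / 2 + l * m + Complex.I * r) - l / 2 := by ring
  have e3 : s + 3 * l / 2 - 1 / 2 + l * m + Complex.I * r
      = (s + l - 1 / 2 + l * m + Complex.I * r) + l / 2 := by ring
  rw [phiTerm_eq hl hs]
  rw [e2] at n2 ⊢
  rw [e3] at n3 ⊢
  generalize s + l - 1 / 2 + l * m + Complex.I * r = z at *
  rw [← mul_inv, ← mul_inv, inv_sub_inv (by positivity) (mul_ne_zero n2 n3), div_eq_mul_inv,
    show z * z * (z - l / 2) * (z + l / 2) = z * z * ((z - l / 2) * (z + l / 2)) by ring]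
  congr 1
  ring

/-- The second-order cancellation in `phiTerm` leaves decay of order four in `1 + m + |r|`. It is
split as `3/2 + 5/2`: `3/2` makes the sum over `m` converge, and `5/2` covers both the integral over
`r` and the growth `5/4` of the weights from `tanh`. -/
theorem exists_norm_phiTerm_le {l : ℕ} (hl : 1 ≤ l) {s : ℂ} (hs : (1 - (l : ℝ)) / 2 < s.re) :
    ∃ C : ℝ, 0 ≤ C ∧ ∀ (m : ℕ) (r : ℝ), ‖phiTerm l s m r‖
      ≤ C * (((m : ℝ) + 1) ^ (-(3 / 2) : ℝ) * (1 + |r|) ^ (-(5 / 2) : ℝ)) := by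
  obtain ⟨h1, h2, h3⟩ := re_pos_of_lt hl hs
  obtain ⟨K1, hK1, H1⟩ := exists_le_norm_add hl h1
  obtain ⟨K2, hK2, H2⟩ := exists_le_norm_add hl h2
  obtain ⟨K3, hK3, H3⟩ := exists_le_norm_add hl h3
  refine ⟨(l : ℝ) ^ 2 / 4 * (K1 * K1 * K2 * K3), by positivity, fun m r => ?_⟩
  have n1 := norm_pos_iff.2 (add_I_mul_ne_zero (re_add_mul_pos h1 l m) r)
  have n2 := norm_pos_iff.2 (add_I_mul_ne_zero (re_add_mul_pos h2 l m) r)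
  have n3 := norm_pos_iff.2 (add_I_mul_ne_zero (re_add_mul_pos h3 l m) r)
  have H1 := H1 m r
  have H2 := H2 m r
  have H3 := H3 m r
  rw [phiTerm_eq_inv hl hs]
  set z1 := ‖s + l - 1 / 2 + l * m + Complex.I * r‖
  set z2 := ‖s + l / 2 - 1 / 2 + l * m + Complex.I * r‖
  set z3 := ‖s + 3 * l / 2 - 1 / 2 + l * m + Complex.I * r‖
  set X : ℝ := 1 + m + |r| with hX
  have hm : (0 : ℝ) ≤ m := Nat.cast_nonneg m
  have hr := abs_nonneg r
  have hXpos : 0 < X := by positivity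
  have hX4 : X ^ 4 ≤ (K1 * K1 * K2 * K3) * (z1 * z1 * z2 * z3) := by
    calc X ^ 4 = X * X * X * X := by ring
      _ ≤ (K1 * z1) * (K1 * z1) * (K2 * z2) * (K3 * z3) := by gcongr
      _ = _ := by ring
  have hinv : (z1 * z1 * z2 * z3)⁻¹ ≤ (K1 * K1 * K2 * K3) * (X ^ 4)⁻¹ := by
    rw [← div_eq_mul_inv, le_div_iff₀ (by positivity), inv_mul_le_iff₀ (by positivity)]
    linarith
  have hrp : (X ^ 4)⁻¹ ≤ ((m : ℝ) + 1) ^ (-(3 / 2) : ℝ) * (1 + |r|) ^ (-(5 / 2) : ℝ) := by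
    have e : (X ^ 4)⁻¹ = X ^ (-(3 / 2) : ℝ) * X ^ (-(5 / 2) : ℝ) := by
      rw [← Real.rpow_add hXpos, ← Real.rpow_natCast, ← Real.rpow_neg hXpos.le]
      norm_num
    rw [e]
    gcongr ?_ * ?_
    · exact Real.rpow_le_rpow_of_nonpos (by linarith) (by linarith) (by norm_num)
    · exact Real.rpow_le_rpow_of_nonpos (by linarith) (by linarith) (by norm_num)
  have hnorm : ‖-((l : ℂ) ^ 2 / 4)‖ = (l : ℝ) ^ 2 / 4 := by simp
  rw [norm_mul, norm_inv, norm_mul, norm_mul, norm_mul, hnorm]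
  calc (l : ℝ) ^ 2 / 4 * (z1 * z1 * z2 * z3)⁻¹
      ≤ (l : ℝ) ^ 2 / 4 * ((K1 * K1 * K2 * K3) * (((m : ℝ) + 1) ^ (-(3 / 2) : ℝ)
        * (1 + |r|) ^ (-(5 / 2) : ℝ))) := by
        gcongr
        exact hinv.trans (by gcongr)
    _ = _ := by ring

/-- The quotient is at most `1` and at most `q²`, hence at most `q ^ (5/4)`. An exponent above `1`
makes the sum over `k` converge, and `5/2 - 5/4 > 1` keeps the integral over `r` convergent. -/
theorem sq_div_sq_add_sq_le (r : ℝ) (k : ℕ) :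
    r ^ 2 / (r ^ 2 + ((k : ℝ) + 1 / 2) ^ 2)
      ≤ (2 : ℝ) ^ (5 / 4 : ℝ) * (((k : ℝ) + 1) ^ (-(5 / 4) : ℝ) * (1 + |r|) ^ (5 / 4 : ℝ)) := by
  have hk : (0 : ℝ) ≤ k := Nat.cast_nonneg k
  have hr := abs_nonneg r
  set q : ℝ := 2 * (1 + |r|) / (k + 1) with hq
  have hqpos : 0 < q := by positivity
  have e : (2 : ℝ) ^ (5 / 4 : ℝ) * (((k : ℝ) + 1) ^ (-(5 / 4) : ℝ) * (1 + |r|) ^ (5 / 4 : ℝ))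
      = q ^ (5 / 4 : ℝ) := by
    rw [hq, Real.div_rpow (by positivity) (by positivity), Real.mul_rpow (by norm_num)
      (by positivity), Real.rpow_neg (by positivity)]
    ring
  rw [e]
  rcases le_total 1 q with h1 | h1
  · calc r ^ 2 / (r ^ 2 + ((k : ℝ) + 1 / 2) ^ 2) ≤ 1 :=
          div_le_one_of_le₀ (by nlinarith [sq_nonneg ((k : ℝ) + 1 / 2)]) (by positivity)
      _ ≤ q ^ (5 / 4 : ℝ) := Real.one_le_rpow h1 (by norm_num)
  · have h2 : q ^ (2 : ℝ) ≤ q ^ (5 / 4 : ℝ) :=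
      Real.rpow_le_rpow_of_exponent_ge hqpos h1 (by norm_num)
    refine le_trans ?_ h2
    rw [Real.rpow_ofNat, hq, div_pow, div_le_div_iff₀ (by positivity) (by positivity)]
    have h3 : r ^ 2 ≤ (1 + |r|) ^ 2 := by nlinarith [sq_abs r]
    have h4 : ((k : ℝ) + 1) ^ 2 ≤ 4 * (r ^ 2 + ((k : ℝ) + 1 / 2) ^ 2) := by nlinarith [sq_nonneg r]
    calc r ^ 2 * ((k : ℝ) + 1) ^ 2 ≤ (1 + |r|) ^ 2 * (4 * (r ^ 2 + ((k : ℝ) + 1 / 2) ^ 2)) := by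
          gcongr
      _ = _ := by ring

/-- The summands of the double series for `φ_s (r) * r * tanh (π r)`. -/
noncomputable def doubleTerm (l : ℕ) (s : ℂ) (p : ℕ × ℕ) (r : ℝ) : ℂ :=
  phiTerm l s p.1 r * ((r ^ 2 / (r ^ 2 + ((p.2 : ℝ) + 1 / 2) ^ 2) : ℝ) : ℂ)

theorem summable_add_one_rpow {x : ℝ} (hx : x < -1) : Summable fun k : ℕ => ((k : ℝ) + 1) ^ x := by
  simpa using (summable_nat_add_iff 1).2 (Real.summable_nat_rpow.2 hx)

theorem summable_doubleBound : Summable fun p : ℕ × ℕ =>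
    ((p.1 : ℝ) + 1) ^ (-(3 / 2) : ℝ) * ((p.2 : ℝ) + 1) ^ (-(5 / 4) : ℝ) :=
  (summable_add_one_rpow (by norm_num)).mul_of_nonneg (summable_add_one_rpow (by norm_num))
    (fun _ => by positivity) (fun _ => by positivity)

theorem exists_norm_doubleTerm_le {l : ℕ} (hl : 1 ≤ l) {s : ℂ}
    (hs : (1 - (l : ℝ)) / 2 < s.re) :
    ∃ C : ℝ, 0 ≤ C ∧ ∀ (p : ℕ × ℕ) (r : ℝ), ‖doubleTerm l s p r‖
      ≤ C * (((p.1 : ℝ) + 1) ^ (-(3 / 2) : ℝ) * ((p.2 : ℝ) + 1) ^ (-(5 / 4) : ℝ))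
        * (1 + |r|) ^ (-(5 / 4) : ℝ) := by
  obtain ⟨C, hC, h⟩ := exists_norm_phiTerm_le hl hs
  refine ⟨C * (2 : ℝ) ^ (5 / 4 : ℝ), by positivity, fun p r => ?_⟩
  have hr := abs_nonneg r
  have h0 : 0 ≤ r ^ 2 / (r ^ 2 + ((p.2 : ℝ) + 1 / 2) ^ 2) := by positivity
  rw [doubleTerm, norm_mul, Complex.norm_of_nonneg h0]
  calc _ ≤ C * (((p.1 : ℝ) + 1) ^ (-(3 / 2) : ℝ) * (1 + |r|) ^ (-(5 / 2) : ℝ))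
        * ((2 : ℝ) ^ (5 / 4 : ℝ) * (((p.2 : ℝ) + 1) ^ (-(5 / 4) : ℝ) * (1 + |r|) ^ (5 / 4 : ℝ))) :=
        mul_le_mul (h p.1 r) (sq_div_sq_add_sq_le r p.2) h0 (by positivity)
    _ = C * (2 : ℝ) ^ (5 / 4 : ℝ) * (((p.1 : ℝ) + 1) ^ (-(3 / 2) : ℝ)
        * ((p.2 : ℝ) + 1) ^ (-(5 / 4) : ℝ))
        * ((1 + |r|) ^ (-(5 / 2) : ℝ) * (1 + |r|) ^ (5 / 4 : ℝ)) := by ring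
    _ = _ := by
        rw [← Real.rpow_add (by positivity)]
        norm_num

theorem doubleTerm_eq {l : ℕ} (hl : 1 ≤ l) {s : ℂ} (hs : (1 - (l : ℝ)) / 2 < s.re)
    (p : ℕ × ℕ) (r : ℝ) :
    doubleTerm l s p r
      = (s + l - 1 / 2 + l * p.1 + Complex.I * r)⁻¹ * (s + l - 1 / 2 + l * p.1 + Complex.I * r)⁻¹
          * ((r ^ 2 / (r ^ 2 + ((p.2 : ℝ) + 1 / 2) ^ 2) : ℝ) : ℂ)
        - (s + l / 2 - 1 / 2 + l * p.1 + Complex.I * r)⁻¹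
          * (s + 3 * l / 2 - 1 / 2 + l * p.1 + Complex.I * r)⁻¹
          * ((r ^ 2 / (r ^ 2 + ((p.2 : ℝ) + 1 / 2) ^ 2) : ℝ) : ℂ) := by
  rw [doubleTerm, phiTerm_eq hl hs]
  ring

theorem integrable_doubleTerm {l : ℕ} (hl : 1 ≤ l) {s : ℂ} (hs : (1 - (l : ℝ)) / 2 < s.re)
    (p : ℕ × ℕ) : Integrable (doubleTerm l s p) := by
  obtain ⟨h1, h2, h3⟩ := re_pos_of_lt hl hs
  have hb : (0 : ℝ) < (p.2 : ℝ) + 1 / 2 := by positivity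
  rw [funext (doubleTerm_eq hl hs p)]
  exact (integrable_inv_mul_inv_mul_div (re_add_mul_pos h1 l p.1) (re_add_mul_pos h1 l p.1) hb).sub
    (integrable_inv_mul_inv_mul_div (re_add_mul_pos h2 l p.1) (re_add_mul_pos h3 l p.1) hb)

/-- Adding `b = k + 1/2` to the parameters removes their `-1/2`, and `π b = (π/2) (2 k + 1)`. -/
theorem integral_doubleTerm {l : ℕ} (hl : 1 ≤ l) {s : ℂ} (hs : (1 - (l : ℝ)) / 2 < s.re)
    (p : ℕ × ℕ) :
    ∫ r : ℝ, doubleTerm l s p r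
      = -(Real.pi / 2) * ((2 * p.2 + 1) * invSqDefect l (s + l + p.2 + l * p.1)) := by
  obtain ⟨h1, h2, h3⟩ := re_pos_of_lt hl hs
  have hl0 : (l : ℂ) ≠ 0 := by exact_mod_cast (by omega : l ≠ 0)
  have hb : (0 : ℝ) < (p.2 : ℝ) + 1 / 2 := by positivity
  have g1 := re_add_mul_pos h1 l p.1
  have g2 := re_add_mul_pos h2 l p.1
  have g3 := re_add_mul_pos h3 l p.1
  rw [funext (doubleTerm_eq hl hs p), integral_sub (integrable_inv_mul_inv_mul_div g1 g1 hb)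
    (integrable_inv_mul_inv_mul_div g2 g3 hb), integral_inv_mul_inv_mul_div g1 g1 hb,
    integral_inv_mul_inv_mul_div g2 g3 hb, invSqDefect]
  have e1 : s + l - 1 / 2 + l * p.1 + ((p.2 + 1 / 2 : ℝ) : ℂ) = s + l + p.2 + l * p.1 := by
    push_cast; ring
  have e2 : s + l / 2 - 1 / 2 + l * p.1 + ((p.2 + 1 / 2 : ℝ) : ℂ)
      = s + l + p.2 + l * p.1 - l / 2 := by push_cast; ring
  have e3 : s + 3 * l / 2 - 1 / 2 + l * p.1 + ((p.2 + 1 / 2 : ℝ) : ℂ)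
      = s + l + p.2 + l * p.1 + l / 2 := by push_cast; ring
  have hne : ∀ a : ℂ, 0 < a.re → a + ((p.2 + 1 / 2 : ℝ) : ℂ) ≠ 0 := by
    intro a ha h
    have := congrArg Complex.re h
    simp only [Complex.add_re, Complex.ofReal_re, Complex.zero_re] at this
    linarith
  have n1 := hne _ g1
  have n2 := hne _ g2
  have n3 := hne _ g3
  rw [e1] at n1 ⊢
  rw [e2] at n2 ⊢
  rw [e3] at n3 ⊢
  generalize s + l + p.2 + l * p.1 = y at *
  have : 1 / (l : ℂ) * (1 / (y - l / 2) - 1 / (y + l / 2)) = ((y - l / 2) * (y + l / 2))⁻¹ := by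
    rw [div_sub_div _ _ n2 n3, mul_inv]
    field_simp
    ring
  rw [this]
  push_cast
  ring

theorem summable_norm_phiTerm {l : ℕ} (hl : 1 ≤ l) {s : ℂ} (hs : (1 - (l : ℝ)) / 2 < s.re)
    (r : ℝ) : Summable fun m => ‖phiTerm l s m r‖ := by
  obtain ⟨C, hC, h⟩ := exists_norm_phiTerm_le hl hs
  refine Summable.of_nonneg_of_le (fun _ => norm_nonneg _) (fun m => h m r) ?_
  exact ((summable_add_one_rpow (by norm_num)).mul_right _).mul_left C

theorem hasSum_mul_of_summable_norm {f g : ℕ → ℂ} {a b : ℂ} (hf : HasSum f a) (hg : HasSum g b)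
    (hf' : Summable fun m => ‖f m‖) :
    HasSum (fun p : ℕ × ℕ => f p.1 * g p.2) (a * b) :=
  hf.mul hg (summable_mul_of_summable_norm hf' hg.summable.norm)

theorem hasSum_doubleTerm {l : ℕ} (hl : 1 ≤ l) {s : ℂ} (hs : (1 - (l : ℝ)) / 2 < s.re) (r : ℝ) :
    HasSum (fun p => doubleTerm l s p r)
      (phi l s r * ((Real.pi / 2 * (r * Real.tanh (Real.pi * r)) : ℝ) : ℂ)) := by
  have h1 := summable_norm_phiTerm hl hs r
  have h2 := Complex.hasSum_ofReal.2 (hasSum_mul_tanh r)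
  have h3 : HasSum (fun m => phiTerm l s m r) (phi l s r) := h1.of_norm.hasSum
  have h4 := hasSum_mul_of_summable_norm h3 h2 h1
  simpa only [doubleTerm] using h4

theorem phi_mul_tanh_integrable {l : ℕ} (hl : 1 ≤ l) {s : ℂ} (hs : (1 - (l : ℝ)) / 2 < s.re) :
    Integrable fun r : ℝ => phi l s r * (r : ℂ) * (Real.tanh (Real.pi * r) : ℂ) := by
  obtain ⟨C, hC, h⟩ := exists_norm_doubleTerm_le hl hs
  obtain ⟨h1, h2, h3⟩ := re_pos_of_lt hl hs
  set B : ℕ × ℕ → ℝ := fun p =>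
    C * (((p.1 : ℝ) + 1) ^ (-(3 / 2) : ℝ) * ((p.2 : ℝ) + 1) ^ (-(5 / 4) : ℝ)) with hB
  have hBs : Summable B := summable_doubleBound.mul_left C
  -- Continuity of the double series supplies the measurability needed for domination by `(1 + |r|)
  -- ^ (-5/4)`.
  have hcont : Continuous fun r : ℝ => ∑' p, doubleTerm l s p r := by
    refine continuous_tsum (u := B) (fun p => ?_) hBs fun p r => ?_
    · rw [funext (doubleTerm_eq hl hs p)]
      have hw : Continuous fun r : ℝ =>
          ((r ^ 2 / (r ^ 2 + ((p.2 : ℝ) + 1 / 2) ^ 2) : ℝ) : ℂ) := by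
        refine Complex.continuous_ofReal.comp (Continuous.div (by fun_prop) (by fun_prop) ?_)
        intro r
        positivity
      have c1 := continuous_inv_add_I_mul (re_add_mul_pos h1 l p.1)
      have c2 := continuous_inv_add_I_mul (re_add_mul_pos h2 l p.1)
      have c3 := continuous_inv_add_I_mul (re_add_mul_pos h3 l p.1)
      exact ((c1.mul c1).mul hw).sub ((c2.mul c3).mul hw)
    · refine (h p r).trans (mul_le_of_le_one_right (by positivity) ?_)
      exact Real.rpow_le_one_of_one_le_of_nonpos (by linarith [abs_nonneg r]) (by norm_num)
  have hint : Integrable fun r : ℝ => ∑' p, doubleTerm l s p r := by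
    have hJ : Integrable fun r : ℝ => (1 + ‖r‖) ^ (-(5 / 4) : ℝ) :=
      integrable_one_add_norm (by simp; norm_num)
    refine (hJ.const_mul (∑' p, B p)).mono' hcont.aestronglyMeasurable
      (Eventually.of_forall fun r => ?_)
    rw [← tsum_mul_right]
    exact tsum_of_norm_bounded (hBs.mul_right _).hasSum fun p => h p r
  refine (hint.const_mul (2 / Real.pi : ℂ)).congr (Eventually.of_forall fun r => ?_)
  have hpi : (Real.pi : ℂ) ≠ 0 := by exact_mod_cast Real.pi_ne_zero
  simp only
  rw [(hasSum_doubleTerm hl hs r).tsum_eq]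
  push_cast
  field_simp

theorem hasSum_integral_phi {l : ℕ} (hl : 1 ≤ l) {s : ℂ} (hs : (1 - (l : ℝ)) / 2 < s.re) :
    HasSum (fun p : ℕ × ℕ => -((2 * p.2 + 1) * invSqDefect l (s + l + p.2 + l * p.1)))
      (∫ r : ℝ, phi l s r * (r : ℂ) * (Real.tanh (Real.pi * r) : ℂ)) := by
  obtain ⟨C, hC, h⟩ := exists_norm_doubleTerm_le hl hs
  have hJ : Integrable fun r : ℝ => (1 + |r|) ^ (-(5 / 4) : ℝ) :=
    integrable_one_add_norm (by simp; norm_num)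
  have hsum : Summable fun p => ∫ r, ‖doubleTerm l s p r‖ := by
    refine Summable.of_nonneg_of_le (fun p => integral_nonneg fun r => norm_nonneg _) (fun p =>
      (integral_mono (integrable_doubleTerm hl hs p).norm (hJ.const_mul _) (h p)).trans_eq
        (integral_const_mul _ _)) ?_
    exact (summable_doubleBound.mul_left C).mul_right _
  have H := hasSum_integral_of_summable_integral_norm (integrable_doubleTerm hl hs) hsum
  have hpi : (Real.pi : ℂ) ≠ 0 := by exact_mod_cast Real.pi_ne_zero
  have e : ∫ r : ℝ, ∑' p, doubleTerm l s p r
      = Real.pi / 2 * ∫ r : ℝ, phi l s r * (r : ℂ) * (Real.tanh (Real.pi * r) : ℂ) := by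
    rw [← integral_const_mul]
    refine integral_congr_ae (Eventually.of_forall fun r => ?_)
    simp only
    rw [(hasSum_doubleTerm hl hs r).tsum_eq]
    push_cast
    ring
  rw [e] at H
  simp only [integral_doubleTerm hl hs] at H
  have H2 := H.mul_left (2 / Real.pi : ℂ)
  have e2 : (2 / Real.pi : ℂ) * (Real.pi / 2 * ∫ r : ℝ, phi l s r * (r : ℂ)
      * (Real.tanh (Real.pi * r) : ℂ))
      = ∫ r : ℝ, phi l s r * (r : ℂ) * (Real.tanh (Real.pi * r) : ℂ) := by
    field_simp
  rw [e2] at H2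
  refine H2.congr_fun fun p => ?_
  field_simp

/-! ### Regrouping the double series and the value of the integral -/

theorem sum_antidiagonal_weight (l n r : ℕ) :
    ∑ p ∈ Finset.HasAntidiagonal.antidiagonal n, (2 * ((p.2 * l + r : ℕ) : ℂ) + 1)
      = ((n : ℂ) + 1) * (l * n + 2 * r + 1) := by
  rw [Finset.Nat.sum_antidiagonal_eq_sum_range_succ_mk, ← Finset.sum_range_reflect]
  have : ∀ j ∈ Finset.range n.succ, (2 * (((n - (n.succ - 1 - j)) * l + r : ℕ) : ℂ) + 1)
      = 2 * ((j * l + r : ℕ) : ℂ) + 1 := by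
    intro j hj
    rw [show n - (n.succ - 1 - j) = j by grind]
  rw [Finset.sum_congr rfl this]
  clear this
  induction n with
  | zero => simp
  | succ n ih =>
    rw [Finset.sum_range_succ, ih]
    push_cast
    ring

/-- Writing `k = j l + r` with `r < l`, the point `s + l + k + l m` depends only on `r` and `n = m +
j`. The weights `2 k + 1` add up along `m + j = n` to those of the series for `logF`. The
rearrangement is legitimate because `HasSum` is unconditional. -/
theorem hasSum_antidiagonal {l : ℕ} (hl : 1 ≤ l) {s S : ℂ}
    (h : HasSum (fun p : ℕ × ℕ => -((2 * p.2 + 1) * invSqDefect l (s + l + p.2 + l * p.1))) S) :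
    HasSum (fun n : ℕ => ∑ r ∈ Finset.range l,
      -(((n : ℂ) + 1) * (l * n + 2 * r + 1)) * invSqDefect l (s + l + r + l * n)) S := by
  have : NeZero l := ⟨by omega⟩
  have h1 := (((Equiv.prodAssoc ℕ ℕ (Fin l)).trans
    ((Equiv.refl ℕ).prodCongr (Nat.divModEquiv l).symm)).hasSum_iff).2 h
  have h2 := h1.prod_fiberwise fun p => hasSum_fintype _
  have h3 := (Finset.HasAntidiagonal.sigmaAntidiagonalEquivProd.hasSum_iff).2 h2
  have h4 := h3.sigma fun n => hasSum_fintype _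
  convert h4 using 1
  funext n
  have e : ∀ p ∈ Finset.HasAntidiagonal.antidiagonal n, ∀ r : ℕ,
      s + l + ((p.2 * l + r : ℕ) : ℂ) + l * p.1 = s + l + r + l * n := by
    intro p hp r
    rw [← Finset.HasAntidiagonal.mem_antidiagonal.1 hp]
    push_cast
    ring
  have key : ∑ r ∈ Finset.range l,
      -(((n : ℂ) + 1) * (l * n + 2 * r + 1)) * invSqDefect l (s + l + r + l * n)
      = ∑ p ∈ Finset.HasAntidiagonal.antidiagonal n, ∑ r : Fin l, -((2 * ((p.2 * l + r : ℕ) : ℂ) + 1)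
        * invSqDefect l (s + l + ((p.2 * l + r : ℕ) : ℂ) + l * p.1)) := by
    rw [Finset.sum_comm, Finset.sum_range]
    refine Finset.sum_congr rfl fun r _ => ?_
    rw [← sum_antidiagonal_weight, neg_mul, Finset.sum_mul, ← Finset.sum_neg_distrib]
    exact Finset.sum_congr rfl fun p hp => by rw [e p hp]
  rw [key, ← Finset.sum_coe_sort (Finset.HasAntidiagonal.antidiagonal n)]
  rfl

/-- `r tanh (π r)` is even, so `φ_s (r)` and `φ_s (-r)` contribute equally, which explains the
factor `2`. -/
theorem integral_testFun {l : ℕ} (hl : 1 ≤ l) {s : ℂ} (hs : (1 - (l : ℝ)) / 2 < s.re) :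
    (Integrable fun r : ℝ => testFun l s r * (r : ℂ) * (Real.tanh (Real.pi * r) : ℂ)) ∧
    ∫ r : ℝ, testFun l s r * (r : ℂ) * (Real.tanh (Real.pi * r) : ℂ)
      = 2 * (deriv (deriv (logF l)) s - 1 / l * deriv logG (s + l / 2)) := by
  have hs' : -(l : ℝ) / 2 < s.re := by linarith
  have hi := phi_mul_tanh_integrable hl hs
  have hval := tendsto_nhds_unique (hasSum_antidiagonal hl (hasSum_integral_phi hl hs)).tendsto_sum_nat
    (tendsto_logF_meanDefect hl hs')
  rw [deriv_logG hl hs', ← hval]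
  set g : ℝ → ℂ := fun r => phi l s r * (r : ℂ) * (Real.tanh (Real.pi * r) : ℂ) with hg
  have e : (fun r : ℝ => testFun l s r * (r : ℂ) * (Real.tanh (Real.pi * r) : ℂ))
      = fun r => g r + g (-r) := by
    funext r
    simp only [hg, testFun, mul_neg, Real.tanh_neg]
    push_cast
    ring
  rw [e]
  refine ⟨hi.add hi.comp_neg, ?_⟩
  rw [integral_add hi hi.comp_neg, integral_neg_eq_self]
  ring

/-! ### The factors as exponentials, and the conclusion -/

theorem XiHigherI_eq (Γ : Subgroup SL(2, ℤ)) {l : ℕ} (hl : 1 ≤ l) {s : ℂ}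
    (hs : -(l : ℝ) < s.re) :
    XiHigherI Γ l s = Complex.exp ((vol Γ : ℂ) / (2 * Real.pi) * logF l s) := by
  rw [XiHigherI, logBranch_F hl hs]

theorem XiI_eq (Γ : Subgroup SL(2, ℤ)) {s : ℂ} (hs : 0 < s.re) :
    XiI Γ s = Complex.exp ((vol Γ : ℂ) / (2 * Real.pi) * logG s) := by
  rw [XiI, logBranch_Gamma₂ hs, logG]

theorem logDeriv_eq_of_eq_exp {f Φ : ℂ → ℂ} {U : Set ℂ} (hU : IsOpen U) (c : ℂ)
    (hΦ : DifferentiableOn ℂ Φ U) (hf : ∀ w ∈ U, f w = Complex.exp (c * Φ w)) {w : ℂ}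
    (hw : w ∈ U) : logDeriv f w = c * deriv Φ w := by
  have hev : f =ᶠ[𝓝 w] fun u => Complex.exp (c * Φ u) := by
    filter_upwards [hU.mem_nhds hw] with u hu using hf u hu
  rw [logDeriv_apply, hev.deriv_eq, hf w hw,
    (((hΦ.differentiableAt (hU.mem_nhds hw)).hasDerivAt.const_mul c).cexp).deriv]
  field_simp

theorem analyticAt_of_eq_exp {f Φ : ℂ → ℂ} {U : Set ℂ} (hU : IsOpen U) (c : ℂ)
    (hΦ : DifferentiableOn ℂ Φ U) (hf : ∀ w ∈ U, f w = Complex.exp (c * Φ w)) {w : ℂ}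
    (hw : w ∈ U) : AnalyticAt ℂ f w ∧ f w ≠ 0 := by
  refine ⟨?_, by rw [hf w hw]; exact Complex.exp_ne_zero _⟩
  have : DifferentiableOn ℂ f U := ((hΦ.const_mul c).cexp).congr hf
  exact this.analyticAt (hU.mem_nhds hw)

end HigherSelberg

theorem proposition3p3p3 (N : ℕ) (hN : 1 ≤ N) (Γ : Subgroup (Matrix.SpecialLinearGroup (Fin 2) ℤ))
    (hΓ : Γ = CongruenceSubgroup.Gamma0 N ∨ Γ = CongruenceSubgroup.Gamma1 N ∨
      Γ = CongruenceSubgroup.Gamma N)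
    (l : ℕ) (hl : 1 ≤ l) :
    -- both factors are holomorphic (and zero-free) where they are used below
    (∀ s : ℂ, 1 - (l : ℝ) < s.re →
      AnalyticAt ℂ (HigherSelberg.XiHigherI Γ l) s ∧ HigherSelberg.XiHigherI Γ l s ≠ 0) ∧
    (∀ s : ℂ, 0 < s.re →
      AnalyticAt ℂ (HigherSelberg.XiI Γ) s ∧ HigherSelberg.XiI Γ s ≠ 0) ∧
    -- the identity term of the trace formula
    (∀ s : ℂ, (1 - (l : ℝ)) / 2 < s.re →
      Integrable (fun r : ℝ =>
        HigherSelberg.testFun l s r * (r : ℂ) * (Real.tanh (Real.pi * r) : ℂ)) ∧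
      (HigherSelberg.vol Γ : ℂ) / (4 * Real.pi) *
          ∫ r : ℝ, HigherSelberg.testFun l s r * (r : ℂ) * (Real.tanh (Real.pi * r) : ℂ)
        = deriv (logDeriv (HigherSelberg.XiHigherI Γ l)) s
          - 1 / l * logDeriv (HigherSelberg.XiI Γ) (s + l / 2)) ∧
    -- the ladder relation
    (∀ s : ℂ, 1 - (l : ℝ) < s.re →
      HigherSelberg.XiHigherI Γ l s
        = HigherSelberg.XiHigherI Γ l (s + l) / HigherSelberg.XiI Γ (s + l)) := by
  have hlpos : (0 : ℝ) < l := by exact_mod_cast hl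
  refine ⟨fun s hs => ?_, fun s hs => ?_, fun s hs => ?_, fun s hs => ?_⟩
  -- `logF` is holomorphic on the larger half plane `Re s > -l`.
  · exact HigherSelberg.analyticAt_of_eq_exp (HigherSelberg.isOpen_re_gt (-(l : ℝ))) _
      (HigherSelberg.differentiableOn_logF hl) (fun w hw => HigherSelberg.XiHigherI_eq Γ hl hw)
      (show -(l : ℝ) < s.re by linarith)
  · exact HigherSelberg.analyticAt_of_eq_exp (HigherSelberg.isOpen_re_gt 0) _
      HigherSelberg.differentiableOn_logG (fun w hw => HigherSelberg.XiI_eq Γ hw) hs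
  · obtain ⟨h1, h2⟩ := HigherSelberg.integral_testFun hl hs
    refine ⟨h1, ?_⟩
    have hpi : (Real.pi : ℂ) ≠ 0 := by exact_mod_cast Real.pi_ne_zero
    have hU := HigherSelberg.isOpen_re_gt (-(l : ℝ))
    have hsU : s ∈ {s : ℂ | -(l : ℝ) < s.re} := show -(l : ℝ) < s.re by linarith
    have hp : s + l / 2 ∈ {s : ℂ | 0 < s.re} := by
      rw [show (l : ℂ) / 2 = ((l / 2 : ℝ) : ℂ) by push_cast; rfl]
      simp only [Set.mem_ofPred_eq, Complex.add_re, Complex.ofReal_re]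
      linarith
    have hd : deriv (logDeriv (HigherSelberg.XiHigherI Γ l)) s
        = (HigherSelberg.vol Γ : ℂ) / (2 * Real.pi) * deriv (deriv (HigherSelberg.logF l)) s := by
      have hev : logDeriv (HigherSelberg.XiHigherI Γ l) =ᶠ[nhds s] fun w =>
          (HigherSelberg.vol Γ : ℂ) / (2 * Real.pi) * deriv (HigherSelberg.logF l) w := by
        filter_upwards [hU.mem_nhds hsU] with w hw
        exact HigherSelberg.logDeriv_eq_of_eq_exp hU _ (HigherSelberg.differentiableOn_logF hl)
          (fun w hw => HigherSelberg.XiHigherI_eq Γ hl hw) hw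
      rw [hev.deriv_eq]
      exact deriv_const_mul _ (((HigherSelberg.differentiableOn_logF hl).deriv hU).differentiableAt
        (hU.mem_nhds hsU))
    rw [h2, hd, HigherSelberg.logDeriv_eq_of_eq_exp (HigherSelberg.isOpen_re_gt 0) _
      HigherSelberg.differentiableOn_logG (fun w hw => HigherSelberg.XiI_eq Γ hw) hp]
    field_simp
    ring
  · have h1 : -(l : ℝ) < s.re := by linarith
    have h2 := HigherSelberg.re_add_pos h1
    have h3 : -(l : ℝ) < (s + l).re := by linarith
    rw [HigherSelberg.XiHigherI_eq Γ hl h1, HigherSelberg.XiHigherI_eq Γ hl h3,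
      HigherSelberg.XiI_eq Γ h2, ← Complex.exp_sub, HigherSelberg.logF_add hl h1]
    congr 1
    ring
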